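/- Let $n\ge 1$ and let $(M,\xi)$ be a closed (compact, without boundary, not necessarily connected) cooriented contact manifold of dimension $2n+1$, i.e. $\xi=\ker\alpha$ for a global smooth $1$-form $\alpha$ such that $\alpha\wedge(d\alpha)^n$ is a volume form, the coorientation being the one defined by $\alpha$. Let $\mathrm{Diff}_0(M)$ be the identity component of the group of $C^\infty$-diffeomorphisms of $M$ with the $C^\infty$-topology. A loop $(f_t)_{t\in S^1}$, $S^1=\mathbb R/\mathbb Z$, of diffeomorphisms is called positive if $(t,x)\mapsto f_t(x)$ is smooth and the time-dependent vector field $X_t$ generated by it, $X_t(f_t(x))=\partial_t f_t(x)$, satisfies $\alpha(X_t)>0$ everywhere on $M$ for all $t$, where $\alpha$ is any contact form defining the cooriented contact structure $\xi$ (the choice does not matter). Then there exists a homotopy of loops, i.e. a continuous map $H\colon S^1\times[0,1]\to\mathrm{Diff}_0(M)$, such that $H(t,1)=\mathrm{id}$ for all $t\in S^1$, and such that for every $s\in[0,1)$ the loop $t\mapsto H(t,s)$ is a positive loop. -/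

import Mathlib

open scoped Manifold ContDiff

noncomputable section

namespace ContactPositivity

/-- Model space of `d`-dimensional manifolds without boundary. -/
abbrev Model (d : ℕ) : Type := EuclideanSpace ℝ (Fin d)

/-! ### Differential one-forms and contact forms -/

/-- Smooth one-forms on a `d`-dimensional manifold `M`: smooth sections of the bundle with fibre
`T_x M →L[ℝ] ℝ`. -/
abbrev OneForm (d : ℕ) (M : Type*) [TopologicalSpace M] [ChartedSpace (Model d) M]
    [IsManifold (𝓡 d) ∞ M] : Type _ :=
  ContMDiffSection (𝓡 d) (Model d →L[ℝ] ℝ) ∞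
    (fun x : M => TangentSpace (𝓡 d) x →L[ℝ] Bundle.Trivial M ℝ x)

section Forms

variable {d : ℕ} {M : Type*} [TopologicalSpace M] [ChartedSpace (Model d) M]
  [IsManifold (𝓡 d) ∞ M]

/-- The value `α_x(v)` of a one-form on a tangent vector. -/
def OneForm.eval (α : OneForm d M) (x : M) (v : TangentSpace (𝓡 d) x) : ℝ := α x v

/-- The pull-back `(φ⁻¹)^* α` of `α` to the target of the chart `φ`. -/
def OneForm.inChart (α : OneForm d M) (φ : OpenPartialHomeomorph M (Model d)) (y : Model d) :
    Model d →L[ℝ] ℝ :=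
  (α (φ.symm y) : TangentSpace (𝓡 d) (φ.symm y) →L[ℝ] ℝ).comp
    (mfderiv (𝓡 d) (𝓡 d) φ.symm y)

/-- The exterior derivative `(dα)_x(u, v)`, computed in the preferred chart `φ` at `x` by
`d((φ⁻¹)^* α)(u', v') = D((φ⁻¹)^* α)(u')(v') - D((φ⁻¹)^* α)(v')(u')` with `u' = dφ(u)`,
`v' = dφ(v)`. -/
def OneForm.extDeriv (α : OneForm d M) (x : M) (u v : TangentSpace (𝓡 d) x) : ℝ :=
  let φ := chartAt (Model d) x
  let u' : Model d := mfderiv (𝓡 d) (𝓡 d) φ x u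
  let v' : Model d := mfderiv (𝓡 d) (𝓡 d) φ x v
  fderiv ℝ (α.inChart φ) (φ x) u' v' - fderiv ℝ (α.inChart φ) (φ x) v' u'

end Forms

section Contact

variable {n : ℕ} {M : Type*} [TopologicalSpace M] [ChartedSpace (Model (2 * n + 1)) M]
  [IsManifold (𝓡 (2 * n + 1)) ∞ M]

/-- The top-degree form `α ∧ (dα)^n` at `x`, evaluated on `2n+1` tangent vectors:
`2⁻ⁿ ∑_σ sgn(σ) α(v_{σ(0)}) ∏_{i < n} dα(v_{σ(2i+1)}, v_{σ(2i+2)})`. -/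
def OneForm.wedgeExtDerivPow (α : OneForm (2 * n + 1) M) (x : M)
    (v : Fin (2 * n + 1) → TangentSpace (𝓡 (2 * n + 1)) x) : ℝ :=
  ((2 : ℝ) ^ n)⁻¹ * ∑ σ : Equiv.Perm (Fin (2 * n + 1)),
    ((Equiv.Perm.sign σ : ℤ) : ℝ) * (α.eval x (v (σ ⟨0, by omega⟩)) *
      ∏ i : Fin n, α.extDeriv x (v (σ ⟨2 * (i : ℕ) + 1, by omega⟩))
        (v (σ ⟨2 * (i : ℕ) + 2, by omega⟩)))

/-- `α` is a contact form: `α ∧ (dα)^n` is a volume form, i.e. vanishes at no point. -/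
def OneForm.IsContact (α : OneForm (2 * n + 1) M) : Prop :=
  ∀ x : M, ∃ v : Fin (2 * n + 1) → TangentSpace (𝓡 (2 * n + 1)) x, α.wedgeExtDerivPow x v ≠ 0

end Contact

/-- A cooriented contact structure on a `(2n+1)`-dimensional manifold: a field of hyperplanes `ξ`
together with a choice of a positive side of every `ξ_x` in `T_x M`, which are the kernel and the
positive side of some global contact form. -/
structure CoorientedContactStructure (n : ℕ) (M : Type*) [TopologicalSpace M]
    [ChartedSpace (Model (2 * n + 1)) M] [IsManifold (𝓡 (2 * n + 1)) ∞ M] where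
  /-- the hyperplane `ξ_x` -/
  plane : ∀ x : M, Submodule ℝ (TangentSpace (𝓡 (2 * n + 1)) x)
  /-- the vectors positively transverse to `ξ_x` -/
  positiveSide : ∀ x : M, Set (TangentSpace (𝓡 (2 * n + 1)) x)
  exists_contactForm : ∃ α : OneForm (2 * n + 1) M, α.IsContact ∧
    (∀ x v, v ∈ plane x ↔ α.eval x v = 0) ∧ (∀ x v, v ∈ positiveSide x ↔ 0 < α.eval x v)

/-- `α` is a contact form with kernel `ξ` which defines the chosen coorientation of `ξ`. -/
def CoorientedContactStructure.IsDefinedBy {n : ℕ} {M : Type*} [TopologicalSpace M]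
    [ChartedSpace (Model (2 * n + 1)) M] [IsManifold (𝓡 (2 * n + 1)) ∞ M]
    (ξ : CoorientedContactStructure n M) (α : OneForm (2 * n + 1) M) : Prop :=
  α.IsContact ∧ (∀ x v, v ∈ ξ.plane x ↔ α.eval x v = 0) ∧
    (∀ x v, v ∈ ξ.positiveSide x ↔ 0 < α.eval x v)

/-! ### The diffeomorphism group and its topology -/

/-- The smooth diffeomorphisms of `M`. -/
abbrev Diff (d : ℕ) (M : Type*) [TopologicalSpace M] [ChartedSpace (Model d) M] : Type _ :=
  M ≃ₘ^∞⟮𝓡 d, 𝓡 d⟯ M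

section Topology

variable {d : ℕ} {M : Type*} [TopologicalSpace M] [ChartedSpace (Model d) M]

/-- The set of all diffeomorphisms `g` which map `K` into the domain of the chart `ψ` and for which
the derivatives of order at most `r` of `ψ ∘ g ∘ φ⁻¹` are `ε`-close on `φ(K)` to those of
`ψ ∘ f ∘ φ⁻¹`. -/
def Diff.basicNhd (f : Diff d M) (φ ψ : OpenPartialHomeomorph M (Model d)) (K : Set M) (r : ℕ)
    (ε : ℝ) : Set (Diff d M) :=
  {g | Set.MapsTo g K ψ.source ∧ ∀ k ≤ r, ∀ p ∈ K,
    ‖iteratedFDeriv ℝ k (ψ ∘ g ∘ φ.symm) (φ p) - iteratedFDeriv ℝ k (ψ ∘ f ∘ φ.symm) (φ p)‖ < ε}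

/-- The `C^∞` topology on the diffeomorphisms of a compact manifold: uniform convergence, in charts
and on compact sets, of all derivatives. (On a compact manifold the compact-open `C^∞` topology
given here and the Whitney `C^∞` topology coincide.) -/
instance Diff.topology : TopologicalSpace (Diff d M) :=
  TopologicalSpace.generateFrom
    {N | ∃ (f : Diff d M) (φ ψ : OpenPartialHomeomorph M (Model d)) (K : Set M) (r : ℕ) (ε : ℝ),
      φ ∈ IsManifold.maximalAtlas (𝓡 d) ∞ M ∧ ψ ∈ IsManifold.maximalAtlas (𝓡 d) ∞ M ∧
      IsCompact K ∧ K ⊆ φ.source ∧ Set.MapsTo f K ψ.source ∧ 0 < ε ∧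
      N = Diff.basicNhd f φ ψ K r ε}

end Topology

/-- `Diff_0(M)`: the connected component of the identity in the diffeomorphism group of `M`. -/
def Diff₀ (d : ℕ) (M : Type*) [TopologicalSpace M] [ChartedSpace (Model d) M] :
    Set (Diff d M) :=
  connectedComponent (Diffeomorph.refl (𝓡 d) M ∞)

/-! ### Positive paths and positive loops of diffeomorphisms -/

/-- A smooth path `(f_t)_{t ∈ ℝ}` of diffeomorphisms: `(t, x) ↦ f_t(x)` is smooth. -/
def IsSmoothPath {d : ℕ} {M : Type*} [TopologicalSpace M] [ChartedSpace (Model d) M]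
    (f : ℝ → Diff d M) : Prop :=
  ContMDiff (𝓘(ℝ, ℝ).prod (𝓡 d)) (𝓡 d) ∞ (fun p : ℝ × M => f p.1 p.2)

/-- The time-dependent vector field `X_t` generated by the path `(f_t)`, at the point `f_t(x)`:
`X_t(f_t(x)) = ∂_t f_t(x)`. -/
def velocity {d : ℕ} {M : Type*} [TopologicalSpace M] [ChartedSpace (Model d) M]
    (f : ℝ → Diff d M) (t : ℝ) (x : M) : TangentSpace (𝓡 d) (f t x) :=
  mfderiv 𝓘(ℝ, ℝ) (𝓡 d) (fun τ : ℝ => f τ x) t (1 : ℝ)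

/-- A smooth path `(f_t)` of diffeomorphisms is positive if `α(X_t) > 0` for all `t`, where `α` is
any contact form defining the cooriented contact structure. (Every point of `M` is of the form
`f_t(x)`.) -/
def IsPositivePath {n : ℕ} {M : Type*} [TopologicalSpace M] [ChartedSpace (Model (2 * n + 1)) M]
    [IsManifold (𝓡 (2 * n + 1)) ∞ M] (ξ : CoorientedContactStructure n M)
    (f : ℝ → Diff (2 * n + 1) M) : Prop :=
  IsSmoothPath f ∧ ∀ α : OneForm (2 * n + 1) M, ξ.IsDefinedBy α →
    ∀ (t : ℝ) (x : M), 0 < α.eval (f t x) (velocity f t x)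

/-- A loop of diffeomorphisms, parametrised by `S¹ = ℝ/ℤ`, is a positive loop if it is smooth and
positive as a `1`-periodic path. -/
def IsPositiveLoop {n : ℕ} {M : Type*} [TopologicalSpace M] [ChartedSpace (Model (2 * n + 1)) M]
    [IsManifold (𝓡 (2 * n + 1)) ∞ M] (ξ : CoorientedContactStructure n M)
    (γ : UnitAddCircle → Diff (2 * n + 1) M) : Prop :=
  IsPositivePath ξ (fun t : ℝ => γ (t : UnitAddCircle))

end ContactPositivity

end

/-! The constant loop can be perturbed to a positive loop because `ξ` is non-integrable: a small
oscillation tangent to `ξ` gains, at second order, a drift transverse to `ξ` measured by `dα`.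
Shrinking the perturbation back to zero gives the homotopy.

By compactness there is a smooth family `E (v, x)` of self-maps, `v ∈ ℝ^ι`, with `E (0, x) = x` and
`v ↦ E (v, x)` submersive at `0` (`exists_spray`). Pulling `α` back along `v ↦ E (v, x)` gives a
one-form with components `h k (v, x)`. Let `η` be its value at `v = 0` and `D` the matrix of its
first derivatives there; the skew part of `D` is the pull-back of `dα`
(`OneForm.extDeriv_pullback`). For `V = r A + r² B`, with `A` and `B` depending on `(t, x)` and
`1`-periodic in `t`, the value of `α` on the velocity of `t ↦ E (V, x)` is `r (A' ⬝ η) + r² (B' ⬝ η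
+ D(A, A')) + o(r²)`. If `A` is a sum of cosines and sines times fields in the kernel of `η`, the
first-order term vanishes. In `D(A, A')` distinct frequencies do not interact on average, and the
mean is a positive combination of terms `dα(a_k, b_k)`. The choice `b_k = ∑ l, dα(a_k, a_l) a_l`
makes these sums of squares, not all zero because `dα` is nonzero on `ξ` when `n ≥ 1`. The remaining
zero-mean part has a periodic primitive and is cancelled by `B` (`exists_oscillating_fields`).

Hence the velocity is positive for small `r ≠ 0`, uniformly by compactness
(`exists_positive_family`). For small `r` the maps are diffeomorphisms (`eventually_exists_diff`),
and they depend continuously on the parameters in the `C^∞` topology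
(`continuousOn_diff_of_contMDiff`). -/

open scoped Manifold ContDiff

noncomputable section

namespace ContactPositivity

open Set Filter Topology

/-! ### Smoothness of one-forms evaluated on velocities -/

section Pullback

variable {d : ℕ} {M : Type*} [TopologicalSpace M] [ChartedSpace (Model d) M]
  [IsManifold (𝓡 d) ∞ M]
  {EN : Type*} [NormedAddCommGroup EN] [NormedSpace ℝ EN] {HN : Type*} [TopologicalSpace HN]
  {J : ModelWithCorners ℝ EN HN} {N : Type*} [TopologicalSpace N] [ChartedSpace HN N]
  [IsManifold J ∞ N]

/-- The velocity at time `0` of a smooth family of curves is a smooth map to `TM`. -/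
theorem contMDiffAt_velocity_zero {f : N → ℝ → M} {n₀ : N}
    (hf : ContMDiffAt (J.prod 𝓘(ℝ, ℝ)) (𝓡 d) ∞ (Function.uncurry f) (n₀, 0)) :
    ContMDiffAt J (𝓡 d).tangent ∞
      (fun n => (⟨f n 0, mfderiv 𝓘(ℝ, ℝ) (𝓡 d) (f n) 0 (1 : ℝ)⟩ : TangentBundle (𝓡 d) M)) n₀ := by
  have h1 := ContMDiffAt.mfderiv (m := ∞) f (fun _ : N => (0 : ℝ)) hf contMDiffAt_const (by simp)
  have hb : ContMDiffAt J (𝓡 d) ∞ (fun n => f n 0) n₀ :=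
    ContMDiffAt.comp n₀ (g := Function.uncurry f) (f := fun n => (n, (0 : ℝ))) hf
      (contMDiffAt_id.prodMk contMDiffAt_const)
  have hv : ContMDiffAt J (𝓘(ℝ, ℝ).prod 𝓘(ℝ, ℝ)) ∞
      (fun _ : N => (⟨(0 : ℝ), (1 : ℝ)⟩ : TangentBundle 𝓘(ℝ, ℝ) ℝ)) n₀ := contMDiffAt_const
  exact ContMDiffAt.clm_apply_of_inCoordinates (b₁ := fun _ : N => (0 : ℝ)) (b₂ := fun n => f n 0)
    (ϕ := fun n => mfderiv 𝓘(ℝ, ℝ) (𝓡 d) (f n) 0) (v := fun _ => (1 : ℝ))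
    (E₁ := TangentSpace 𝓘(ℝ, ℝ)) (E₂ := TangentSpace (𝓡 d)) h1 hv hb

/-- The value of a smooth one-form on the velocities of a smooth family of curves is smooth. -/
theorem contMDiffAt_eval_velocity_zero (α : OneForm d M) {f : N → ℝ → M} {n₀ : N}
    (hf : ContMDiffAt (J.prod 𝓘(ℝ, ℝ)) (𝓡 d) ∞ (Function.uncurry f) (n₀, 0)) :
    ContMDiffAt J 𝓘(ℝ, ℝ) ∞
      (fun n => α.eval (f n 0) (mfderiv 𝓘(ℝ, ℝ) (𝓡 d) (f n) 0 (1 : ℝ))) n₀ := by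
  have hb : ContMDiffAt J (𝓡 d) ∞ (fun n => f n 0) n₀ :=
    ContMDiffAt.comp n₀ (g := Function.uncurry f) (f := fun n => (n, (0 : ℝ))) hf
      (contMDiffAt_id.prodMk contMDiffAt_const)
  have hα := ContMDiffAt.comp n₀ (f := fun n => f n 0) (α.contMDiff (f n₀ 0)) hb
  have h := ContMDiffAt.clm_bundle_apply (F₁ := Model d) (F₂ := ℝ) (b := fun n => f n 0)
    (E₁ := TangentSpace (𝓡 d)) (E₂ := Bundle.Trivial M ℝ) (ϕ := fun n => α (f n 0))
    hα (contMDiffAt_velocity_zero hf)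
  rw [Bundle.contMDiffAt_totalSpace] at h
  exact h.2

end Pullback



/-! ### Naturality of the exterior derivative -/

section Naturality

variable {d : ℕ} {M : Type*} [TopologicalSpace M] [ChartedSpace (Model d) M]
  {X : Type*} [NormedAddCommGroup X] [NormedSpace ℝ X]

/-- Turns a directional derivative into the velocity of a curve, the form in which smoothness of
`α.eval` is available. -/
theorem mfderiv_comp_line {g : X → M} {y : X} (hg : MDifferentiableAt 𝓘(ℝ, X) (𝓡 d) g y) (w : X) :
    mfderiv 𝓘(ℝ, ℝ) (𝓡 d) (fun σ : ℝ => g (y + σ • w)) 0 (1 : ℝ) =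
      (mfderiv 𝓘(ℝ, X) (𝓡 d) g y w : Model d) := by
  have hl : HasFDerivAt (fun σ : ℝ => y + σ • w)
      ((ContinuousLinearMap.id ℝ ℝ).smulRight w) 0 :=
    ((hasFDerivAt_id (𝕜 := ℝ) (0 : ℝ)).smul_const w).const_add y
  have h0 : y + (0 : ℝ) • w = y := by simp
  have hg' : HasMFDerivAt 𝓘(ℝ, X) (𝓡 d) g (y + (0 : ℝ) • w) (mfderiv 𝓘(ℝ, X) (𝓡 d) g y) := by
    rw [h0]; exact hg.hasMFDerivAt
  have h := HasMFDerivAt.comp (0 : ℝ) hg' hl.hasMFDerivAt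
  have := h.mfderiv
  exact (congrArg (fun L : ℝ →L[ℝ] Model d => L 1) this).trans
    (congrArg (mfderiv 𝓘(ℝ, X) (𝓡 d) g y : X →L[ℝ] Model d) (one_smul ℝ w))

variable [IsManifold (𝓡 d) ∞ M]

/-- Smoothness can be tested on each constant vector `w`, where the value is `α` on the velocity of
`σ ↦ φ.symm (z + σ • w)`. -/
theorem OneForm.contDiffOn_inChart (α : OneForm d M) (φ : OpenPartialHomeomorph M (Model d))
    (hφ : φ ∈ IsManifold.maximalAtlas (𝓡 d) ∞ M) :
    ContDiffOn ℝ ∞ (α.inChart φ) φ.target := by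
  rw [contDiffOn_clm_apply]
  intro w y hy
  have hs : ∀ z ∈ φ.target, ContMDiffAt 𝓘(ℝ, Model d) (𝓡 d) ∞ φ.symm z := fun z hz =>
    (contMDiffOn_symm_of_mem_maximalAtlas hφ).contMDiffAt (φ.open_target.mem_nhds hz)
  have h := contMDiffAt_eval_velocity_zero (J := 𝓘(ℝ, Model d)) α
    (f := fun (z : Model d) (σ : ℝ) => φ.symm (z + σ • w)) (n₀ := y) (by
      have h1 : ContMDiffAt (𝓘(ℝ, Model d).prod 𝓘(ℝ, ℝ)) 𝓘(ℝ, Model d) ∞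
          (fun p : Model d × ℝ => p.1 + p.2 • w) (y, 0) :=
        contMDiffAt_fst.add (contMDiffAt_snd.smul contMDiffAt_const)
      exact ContMDiffAt.comp_of_eq (hs y hy) h1 (by simp))
  refine (contMDiffAt_iff_contDiffAt.1 h).contDiffWithinAt.congr_of_eventuallyEq_of_mem ?_ hy
  filter_upwards [self_mem_nhdsWithin] with z hz
  have hd := mfderiv_comp_line ((hs z hz).mdifferentiableAt (by simp)) w
  have h0 : φ.symm (z + (0 : ℝ) • w) = φ.symm z := by simp
  rw [hd, h0]
  rfl

/-- The exterior derivative commutes with pull-backs to a vector space. -/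
theorem OneForm.extDeriv_pullback (α : OneForm d M) {g : X → M} {y₀ : X}
    (hg : ContMDiffAt 𝓘(ℝ, X) (𝓡 d) ∞ g y₀) (u w : X) :
    fderiv ℝ (fun y => α.eval (g y) (mfderiv 𝓘(ℝ, X) (𝓡 d) g y w)) y₀ u -
      fderiv ℝ (fun y => α.eval (g y) (mfderiv 𝓘(ℝ, X) (𝓡 d) g y u)) y₀ w =
    α.extDeriv (g y₀) (mfderiv 𝓘(ℝ, X) (𝓡 d) g y₀ u) (mfderiv 𝓘(ℝ, X) (𝓡 d) g y₀ w) := by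
  have htwo : (2 : WithTop ℕ∞) ≤ ∞ := ENat.LEInfty.out
  set φ := chartAt (Model d) (g y₀) with hφ
  have hφm : φ ∈ IsManifold.maximalAtlas (𝓡 d) ∞ M := IsManifold.chart_mem_maximalAtlas _
  set e : X → Model d := fun y => φ (g y) with he
  have hsrc : g y₀ ∈ φ.source := mem_chart_source _ _
  have hφs : ContMDiffAt (𝓡 d) 𝓘(ℝ, Model d) ∞ φ (g y₀) :=
    (contMDiffOn_of_mem_maximalAtlas hφm).contMDiffAt (φ.open_source.mem_nhds hsrc)
  have hec : ContDiffAt ℝ ∞ e y₀ := contMDiffAt_iff_contDiffAt.1 (hφs.comp y₀ hg)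
  have hgs : ∀ᶠ y in 𝓝 y₀, g y ∈ φ.source :=
    hg.continuousAt.eventually (φ.open_source.mem_nhds hsrc)
  have hed : ∀ᶠ y in 𝓝 y₀, ContDiffAt ℝ 1 e y :=
    (hec.of_le (m := 1) (by exact_mod_cast le_top)).eventually (by simp)
  -- Near `y₀` one has `g = φ.symm ∘ e`, so the pull-back by `g` is the pull-back by `e` of the
  -- chart representative of `α`.
  have key : ∀ w : X, (fun y => α.eval (g y) (mfderiv 𝓘(ℝ, X) (𝓡 d) g y w)) =ᶠ[𝓝 y₀]
      fun y => α.inChart φ (e y) (fderiv ℝ e y w) := by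
    intro w
    filter_upwards [hgs.eventually_nhds, hed] with y hy hey
    have hy' : g y ∈ φ.source := hy.self_of_nhds
    have hgeq : g =ᶠ[𝓝 y] φ.symm ∘ e := hy.mono fun z hz => (φ.left_inv hz).symm
    have hsm : MDifferentiableAt 𝓘(ℝ, Model d) (𝓡 d) φ.symm (e y) :=
      ((contMDiffOn_symm_of_mem_maximalAtlas hφm).contMDiffAt
        (φ.open_target.mem_nhds (φ.map_source hy'))).mdifferentiableAt (by simp)
    have hem : MDifferentiableAt 𝓘(ℝ, X) 𝓘(ℝ, Model d) e y :=
      (hey.differentiableAt (by simp)).mdifferentiableAt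
    have h1 : (mfderiv 𝓘(ℝ, X) (𝓡 d) g y : X →L[ℝ] Model d) =
        (mfderiv 𝓘(ℝ, Model d) (𝓡 d) φ.symm (e y) : Model d →L[ℝ] Model d).comp (fderiv ℝ e y) := by
      have := hgeq.mfderiv_eq (I := 𝓘(ℝ, X)) (I' := 𝓡 d)
      have h2 := mfderiv_comp y hsm hem
      rw [mfderiv_eq_fderiv] at h2
      exact this.trans h2
    have h3 : φ.symm (e y) = g y := φ.left_inv hy'
    have h4 : ∀ (x' : M) (_ : x' = g y) (v : Model d), α.eval (g y) v = α.eval x' v := by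
      rintro _ rfl v; rfl
    have h5 : (mfderiv 𝓘(ℝ, X) (𝓡 d) g y w : Model d) =
      (mfderiv 𝓘(ℝ, Model d) (𝓡 d) φ.symm (e y) : Model d →L[ℝ] Model d) (fderiv ℝ e y w) :=
      congrArg (fun L : X →L[ℝ] Model d => L w) h1
    exact (h4 _ h3 _).trans (congrArg (fun v : Model d => α.eval (φ.symm (e y)) v) h5)
  have ha : DifferentiableAt ℝ (α.inChart φ) (e y₀) :=
    ((α.contDiffOn_inChart φ hφm).contDiffAt
      (φ.open_target.mem_nhds (φ.map_source hsrc))).differentiableAt (by simp)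
  have hde : DifferentiableAt ℝ (fderiv ℝ e) y₀ :=
    (hec.fderiv_right (m := 1) (by rw [one_add_one_eq_two]; exact htwo)).differentiableAt (by simp)
  have hed0 : DifferentiableAt ℝ e y₀ := hec.differentiableAt (by simp)
  -- Product rule. The term containing the second derivative of `e` is symmetric in `u`, `w` and
  -- drops out of the difference.
  have hD : ∀ u w : X, fderiv ℝ (fun y => α.inChart φ (e y) (fderiv ℝ e y w)) y₀ u =
      fderiv ℝ (α.inChart φ) (e y₀) (fderiv ℝ e y₀ u) (fderiv ℝ e y₀ w) +
        α.inChart φ (e y₀) (fderiv ℝ (fderiv ℝ e) y₀ u w) := by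
    intro u w
    have h1 : HasFDerivAt (fun y => α.inChart φ (e y))
        ((fderiv ℝ (α.inChart φ) (e y₀)).comp (fderiv ℝ e y₀)) y₀ :=
      ha.hasFDerivAt.comp y₀ hed0.hasFDerivAt
    have h2 : HasFDerivAt (fun y => fderiv ℝ e y w)
        ((fderiv ℝ (fderiv ℝ e) y₀).flip w) y₀ := by
      have := hde.hasFDerivAt.clm_apply (hasFDerivAt_const w y₀)
      simpa using this
    rw [(h1.clm_apply h2).fderiv]
    simp [add_comm]
  have hsymm : fderiv ℝ (fderiv ℝ e) y₀ u w = fderiv ℝ (fderiv ℝ e) y₀ w u :=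
    (hec.isSymmSndFDerivAt (by simpa using htwo)).eq u w
  rw [(key w).fderiv_eq, (key u).fderiv_eq, hD, hD, hsymm]
  have hchain : ∀ v : X, (fderiv ℝ e y₀ v : Model d) =
      (mfderiv (𝓡 d) (𝓡 d) φ (g y₀) : Model d →L[ℝ] Model d) (mfderiv 𝓘(ℝ, X) (𝓡 d) g y₀ v) := by
    intro v
    have h2 := mfderiv_comp y₀ (hφs.mdifferentiableAt (by simp)) (hg.mdifferentiableAt (by simp))
    have h3 : (fderiv ℝ e y₀) = mfderiv 𝓘(ℝ, X) 𝓘(ℝ, Model d) (φ ∘ g) y₀ := by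
      rw [mfderiv_eq_fderiv]; rfl
    rw [h3, h2]
    rfl
  rw [hchain, hchain]
  simp only [OneForm.extDeriv]
  have he0 : e y₀ = φ (g y₀) := rfl
  rw [he0]
  abel_nf
  rfl

end Naturality



/-! ### Linear algebra of the contact condition -/

section ContactAlgebra

/-- If a skew form vanishes on the kernel of a linear form `a`, then `a ∧ b^{m+1} = 0`. -/
theorem wedge_sum_eq_zero {V : Type*} [AddCommGroup V] [Module ℝ V] (m : ℕ) (a : V →ₗ[ℝ] ℝ)
    (b : V →ₗ[ℝ] V →ₗ[ℝ] ℝ) (hb : ∀ u w, b u w = -b w u)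
    (h0 : ∀ u w, a u = 0 → a w = 0 → b u w = 0) (v : Fin (2 * (m + 1) + 1) → V) :
    ∑ σ : Equiv.Perm (Fin (2 * (m + 1) + 1)),
      ((Equiv.Perm.sign σ : ℤ) : ℝ) * (a (v (σ ⟨0, by omega⟩)) *
        ∏ i : Fin (m + 1), b (v (σ ⟨2 * (i : ℕ) + 1, by omega⟩))
          (v (σ ⟨2 * (i : ℕ) + 2, by omega⟩))) = 0 := by
  by_cases ha : a = 0
  · simp [ha]
  obtain ⟨R₀, hR₀⟩ : ∃ R, a R ≠ 0 := by
    by_contra! h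
    exact ha (LinearMap.ext h)
  set R := (a R₀)⁻¹ • R₀ with hR
  have haR : a R = 1 := by simp [hR, hR₀]
  have hRR : b R R = 0 := by linarith [hb R R]
  -- Projecting along `R` onto the kernel of `a` shows `b = a ∧ b(R, ·)`, so `a ∧ b` contains `a ∧
  -- a`.
  have hdec : ∀ u w, b u w = a u * b R w - a w * b R u := by
    intro u w
    have := h0 (u - a u • R) (w - a w • R) (by simp [haR]) (by simp [haR])
    simp only [map_sub, map_smul, LinearMap.sub_apply, LinearMap.smul_apply, smul_eq_mul, hRR] at this
    rw [hb u R] at this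
    linarith
  let i₀ : Fin (2 * (m + 1) + 1) := ⟨0, by omega⟩
  let i₁ : Fin (2 * (m + 1) + 1) := ⟨1, by omega⟩
  let i₂ : Fin (2 * (m + 1) + 1) := ⟨2, by omega⟩
  let rest : Equiv.Perm (Fin (2 * (m + 1) + 1)) → ℝ := fun σ =>
    ∏ i : Fin m, b (v (σ ⟨2 * ((i : ℕ) + 1) + 1, by omega⟩))
      (v (σ ⟨2 * ((i : ℕ) + 1) + 2, by omega⟩))
  have hrest : ∀ (σ : Equiv.Perm (Fin (2 * (m + 1) + 1))) (p q : Fin (2 * (m + 1) + 1)),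
      (p : ℕ) < 3 → (q : ℕ) < 3 → rest (σ * Equiv.swap p q) = rest σ := by
    intro σ p q hp hq
    refine Finset.prod_congr rfl fun i _ => ?_
    have hfix : ∀ k : Fin (2 * (m + 1) + 1), 3 ≤ (k : ℕ) → Equiv.swap p q k = k := fun k hk =>
      Equiv.swap_apply_of_ne_of_ne (by rintro rfl; omega) (by rintro rfl; omega)
    simp only [Equiv.Perm.mul_apply]
    rw [hfix _ (by dsimp only; omega), hfix _ (by dsimp only; omega)]
  -- A signed sum vanishes when the summand is invariant under a transposition of two positions.
  have hskew : ∀ (g : Equiv.Perm (Fin (2 * (m + 1) + 1)) → ℝ) (p q : Fin (2 * (m + 1) + 1)),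
      p ≠ q → (∀ σ, g (σ * Equiv.swap p q) = g σ) →
      ∑ σ, ((Equiv.Perm.sign σ : ℤ) : ℝ) * g σ = 0 := by
    intro g p q hpq hg
    have h := Equiv.sum_comp (Equiv.mulRight (Equiv.swap p q))
      (fun σ => ((Equiv.Perm.sign σ : ℤ) : ℝ) * g σ)
    simp only [Equiv.coe_mulRight, hg, Equiv.Perm.sign_mul, Equiv.Perm.sign_swap hpq] at h
    simp only [mul_neg, mul_one, Units.val_neg, Int.cast_neg, neg_mul, Finset.sum_neg_distrib] at h
    linarith
  have h1 := hskew (fun σ => a (v (σ i₀)) * a (v (σ i₁)) * b R (v (σ i₂)) * rest σ) i₀ i₁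
    (by simp [i₀, i₁]) (fun σ => by
      have e : Equiv.swap i₀ i₁ i₂ = i₂ :=
        Equiv.swap_apply_of_ne_of_ne (by simp [i₀, i₂]) (by simp [i₁, i₂])
      simp only [hrest σ i₀ i₁ (by simp [i₀]) (by simp [i₁]), Equiv.Perm.mul_apply,
        Equiv.swap_apply_left, Equiv.swap_apply_right, e]
      ring)
  have h2 := hskew (fun σ => a (v (σ i₀)) * a (v (σ i₂)) * b R (v (σ i₁)) * rest σ) i₀ i₂
    (by simp [i₀, i₂]) (fun σ => by
      have e : Equiv.swap i₀ i₂ i₁ = i₁ :=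
        Equiv.swap_apply_of_ne_of_ne (by simp [i₀, i₁]) (by simp [i₁, i₂])
      simp only [hrest σ i₀ i₂ (by simp [i₀]) (by simp [i₂]), Equiv.Perm.mul_apply,
        Equiv.swap_apply_left, Equiv.swap_apply_right, e]
      ring)
  -- Expanding the first factor `b` by `hdec` splits the sum into the two vanishing sums `h1` and
  -- `h2`.
  rw [← sub_self (0 : ℝ)]
  nth_rewrite 1 [← h1]
  rw [← h2, ← Finset.sum_sub_distrib]
  refine Finset.sum_congr rfl fun σ _ => ?_
  rw [Fin.prod_univ_succ]
  have e1 : b (v (σ ⟨2 * ((0 : Fin (m + 1)) : ℕ) + 1, by omega⟩))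
      (v (σ ⟨2 * ((0 : Fin (m + 1)) : ℕ) + 2, by omega⟩)) = b (v (σ i₁)) (v (σ i₂)) := rfl
  have e2 : (∏ i : Fin m, b (v (σ ⟨2 * (i.succ : ℕ) + 1, by have := i.succ.2; omega⟩))
      (v (σ ⟨2 * (i.succ : ℕ) + 2, by have := i.succ.2; omega⟩))) = rest σ := rfl
  rw [e1, e2, hdec]
  simp only [i₀]
  ring

variable {n : ℕ} {M : Type*} [TopologicalSpace M] [ChartedSpace (Model (2 * n + 1)) M]
  [IsManifold (𝓡 (2 * n + 1)) ∞ M]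

/-- The bilinear map `(u, w) ↦ D(Lu)(Lw) - D(Lw)(Lu)`. -/
def skewPart {V W : Type*} [NormedAddCommGroup V] [NormedSpace ℝ V] [NormedAddCommGroup W]
    [NormedSpace ℝ W] (D : W →L[ℝ] W →L[ℝ] ℝ) (L : V →L[ℝ] W) : V →ₗ[ℝ] V →ₗ[ℝ] ℝ :=
  LinearMap.mk₂ ℝ (fun u w => D (L u) (L w) - D (L w) (L u))
    (fun u u' w => by simp only [map_add, add_apply]; ring)
    (fun c u w => by simp only [map_smul, smul_apply, smul_eq_mul]; ring)
    (fun u w w' => by simp only [map_add, add_apply]; ring)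
    (fun c u w => by simp only [map_smul, smul_apply, smul_eq_mul]; ring)

/-- The exterior derivative at a point as a bilinear map. -/
def OneForm.extDerivLin (α : OneForm (2 * n + 1) M) (x : M) :
    Model (2 * n + 1) →ₗ[ℝ] Model (2 * n + 1) →ₗ[ℝ] ℝ :=
  skewPart (fderiv ℝ (α.inChart (chartAt (Model (2 * n + 1)) x)) (chartAt (Model (2 * n + 1)) x x))
    (mfderiv (𝓡 (2 * n + 1)) (𝓡 (2 * n + 1)) (chartAt (Model (2 * n + 1)) x) x)

theorem OneForm.extDeriv_swap (α : OneForm (2 * n + 1) M) (x : M) (u w : Model (2 * n + 1)) :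
    α.extDeriv x u w = -α.extDeriv x w u := by
  simp only [OneForm.extDeriv]; ring

theorem OneForm.IsContact.exists_eval_ne_zero {α : OneForm (2 * n + 1) M} (hα : α.IsContact)
    (x : M) : ∃ v, α.eval x v ≠ 0 := by
  by_contra! h
  obtain ⟨v, hv⟩ := hα x
  exact hv (by simp [OneForm.wedgeExtDerivPow, h])

/-- Otherwise `wedge_sum_eq_zero` would annihilate `α ∧ (dα)^n`; `n ≥ 1` guarantees that a factor
`dα` is present. Non-vanishing of `dα` on `ξ` is all the non-integrability that the construction
needs. -/
theorem OneForm.IsContact.exists_extDeriv_ne_zero {α : OneForm (2 * n + 1) M} (hα : α.IsContact)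
    (hn : 1 ≤ n) (x : M) :
    ∃ u w, α.eval x u = 0 ∧ α.eval x w = 0 ∧ α.extDeriv x u w ≠ 0 := by
  by_contra! h
  obtain ⟨v, hv⟩ := hα x
  obtain ⟨m, rfl⟩ : ∃ m, n = m + 1 := ⟨n - 1, by omega⟩
  refine hv ?_
  have := wedge_sum_eq_zero m (α x : Model (2 * (m + 1) + 1) →L[ℝ] ℝ).toLinearMap
    (α.extDerivLin x) (α.extDeriv_swap x) h v
  simp only [OneForm.wedgeExtDerivPow]
  exact mul_eq_zero_of_right _ this

end ContactAlgebra



/-! ### Families of maps near the identity consist of diffeomorphisms -/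

section NearIdentity

variable {d : ℕ} {M : Type*} [TopologicalSpace M] [ChartedSpace (Model d) M]
  {P : Type*} [NormedAddCommGroup P] [NormedSpace ℝ P]

/-- The local representative of a smooth family of maps is smooth. -/
theorem contDiffAt_localRep {F : P × M → M}
    (hF : ContMDiff (𝓘(ℝ, P).prod (𝓡 d)) (𝓡 d) ∞ F)
    {φ ψ : OpenPartialHomeomorph M (Model d)} (hφ : φ ∈ IsManifold.maximalAtlas (𝓡 d) ∞ M)
    (hψ : ψ ∈ IsManifold.maximalAtlas (𝓡 d) ∞ M) {p₀ : P} {y₀ : Model d} (hy : y₀ ∈ φ.target)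
    (hs : F (p₀, φ.symm y₀) ∈ ψ.source) :
    ContDiffAt ℝ ∞ (fun q : P × Model d => ψ (F (q.1, φ.symm q.2))) (p₀, y₀) := by
  have h1 : ContMDiffAt 𝓘(ℝ, P × Model d) 𝓘(ℝ, P) ∞ (fun q : P × Model d => q.1) (p₀, y₀) :=
    contMDiffAt_iff_contDiffAt.2 contDiffAt_fst
  have h2 : ContMDiffAt 𝓘(ℝ, P × Model d) 𝓘(ℝ, Model d) ∞ (fun q : P × Model d => q.2) (p₀, y₀) :=
    contMDiffAt_iff_contDiffAt.2 contDiffAt_snd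
  have h3 : ContMDiffAt 𝓘(ℝ, Model d) (𝓡 d) ∞ φ.symm y₀ :=
    (contMDiffOn_symm_of_mem_maximalAtlas hφ).contMDiffAt (φ.open_target.mem_nhds hy)
  have h4 : ContMDiffAt 𝓘(ℝ, P × Model d) (𝓡 d) ∞ (fun q : P × Model d => φ.symm q.2) (p₀, y₀) :=
    ContMDiffAt.comp (p₀, y₀) h3 h2
  have h5 := ContMDiffAt.comp (p₀, y₀) (hF (p₀, φ.symm y₀)) (h1.prodMk h4)
  have h6 := ContMDiffAt.comp (p₀, y₀) (contMDiffAt_of_mem_maximalAtlas hψ hs) h5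
  exact contMDiffAt_iff_contDiffAt.1 h6

/-- A bijective smooth map with invertible differentials is a diffeomorphism. -/
theorem exists_diff_of_bijective {f : M → M} (hf : ContMDiff (𝓡 d) (𝓡 d) ∞ f)
    (hb : Function.Bijective f)
    (h : ∀ x, ∃ φ ∈ IsManifold.maximalAtlas (𝓡 d) ∞ M, x ∈ φ.source ∧ f x ∈ φ.source ∧
      ∃ e : Model d ≃L[ℝ] Model d,
        HasFDerivAt (φ ∘ f ∘ φ.symm) (e : Model d →L[ℝ] Model d) (φ x)) :
    ∃ g : Diff d M, ⇑g = f := by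
  let E := Equiv.ofBijective f hb
  refine ⟨⟨E, hf, ?_⟩, rfl⟩
  intro y
  obtain ⟨x, rfl⟩ := hb.2 y
  obtain ⟨φ, hφ, hx, hfx, e, he⟩ := h x
  set g : Model d → Model d := φ ∘ f ∘ φ.symm with hg
  have hgc : ContDiffAt ℝ ∞ g (φ x) := by
    have h3 : ContMDiffAt 𝓘(ℝ, Model d) (𝓡 d) ∞ φ.symm (φ x) :=
      (contMDiffOn_symm_of_mem_maximalAtlas hφ).contMDiffAt
        (φ.open_target.mem_nhds (φ.map_source hx))
    have h5 := ContMDiffAt.comp (φ x) (hf (φ.symm (φ x))) h3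
    have h6 := ContMDiffAt.comp (φ x) (I'' := 𝓘(ℝ, Model d)) (contMDiffAt_of_mem_maximalAtlas hφ
      (show f (φ.symm (φ x)) ∈ φ.source by rwa [φ.left_inv hx])) h5
    exact contMDiffAt_iff_contDiffAt.1 h6
  have hn : (∞ : WithTop ℕ∞) ≠ 0 := by simp
  have hst := hgc.hasStrictFDerivAt' he hn
  -- The inverse function theorem gives a smooth local right inverse of `f`; injectivity of `f`
  -- identifies it with the global inverse near `f x`.
  set l := hgc.localInverse he hn with hl
  have hgx : g (φ x) = φ (f x) := by simp [hg, φ.left_inv hx]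
  have hlc : ContDiffAt ℝ ∞ l (φ (f x)) := hgx ▸ hgc.to_localInverse he hn
  have hlx : l (φ (f x)) = φ x := hgx ▸ hgc.localInverse_apply_image he hn
  have hlr : ∀ᶠ z in 𝓝 (φ (f x)), g (l z) = z := hgx ▸ hst.eventually_right_inverse
  have hφf : ContMDiffAt (𝓡 d) 𝓘(ℝ, Model d) ∞ φ (f x) := contMDiffAt_of_mem_maximalAtlas hφ hfx
  have hlφ : ContMDiffAt (𝓡 d) 𝓘(ℝ, Model d) ∞ (fun y => l (φ y)) (f x) :=
    ContMDiffAt.comp (f x) (contMDiffAt_iff_contDiffAt.2 hlc) hφf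
  have hs : ContMDiffAt 𝓘(ℝ, Model d) (𝓡 d) ∞ φ.symm (l (φ (f x))) :=
    (contMDiffOn_symm_of_mem_maximalAtlas hφ).contMDiffAt
      (φ.open_target.mem_nhds (hlx ▸ φ.map_source hx))
  have hk : ContMDiffAt (𝓡 d) (𝓡 d) ∞ (fun y => φ.symm (l (φ y))) (f x) :=
    ContMDiffAt.comp (f x) hs hlφ
  have hkx : φ.symm (l (φ (f x))) = x := by rw [hlx, φ.left_inv hx]
  refine hk.congr_of_eventuallyEq ?_
  have hfk : ContinuousAt (fun y => f (φ.symm (l (φ y)))) (f x) :=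
    ContinuousAt.comp (g := f) (hf.continuous.continuousAt) hk.continuousAt
  filter_upwards [φ.open_source.mem_nhds hfx, hφf.continuousAt.eventually hlr,
    hfk.eventually (φ.open_source.mem_nhds (show f (φ.symm (l (φ (f x)))) ∈ φ.source by
      rwa [hkx]))] with y hy1 hy2 hy3
  have : f (φ.symm (l (φ y))) = y := φ.injOn hy3 hy1 hy2
  exact (Equiv.symm_apply_eq E).2 this.symm

variable [IsManifold (𝓡 d) ∞ M] [CompleteSpace P]

/-- The local picture of a smooth family of self-maps near a parameter where it is the identity:
local surjectivity, local injectivity and invertibility of the differentials. -/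
theorem eventually_local_of_eq_id {F : P × M → M}
    (hF : ContMDiff (𝓘(ℝ, P).prod (𝓡 d)) (𝓡 d) ∞ F) {p₀ : P} (h0 : ∀ x, F (p₀, x) = x) (x₀ : M) :
    (∀ᶠ q : P × M in 𝓝 (p₀, x₀), ∃ x, F (q.1, x) = q.2) ∧
    (∀ᶠ q : P × (M × M) in 𝓝 (p₀, (x₀, x₀)), F (q.1, q.2.1) = F (q.1, q.2.2) → q.2.1 = q.2.2) ∧
    (∀ᶠ q : P × M in 𝓝 (p₀, x₀), ∃ φ ∈ IsManifold.maximalAtlas (𝓡 d) ∞ M, q.2 ∈ φ.source ∧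
      F (q.1, q.2) ∈ φ.source ∧ ∃ e : Model d ≃L[ℝ] Model d,
        HasFDerivAt (φ ∘ (fun x => F (q.1, x)) ∘ φ.symm) (e : Model d →L[ℝ] Model d) (φ q.2)) := by
  set φ := chartAt (Model d) x₀ with hφdef
  have hφ : φ ∈ IsManifold.maximalAtlas (𝓡 d) ∞ M := IsManifold.chart_mem_maximalAtlas _
  have hx₀ : x₀ ∈ φ.source := mem_chart_source _ _
  have hy₀ : φ x₀ ∈ φ.target := φ.map_source hx₀
  have hFc : Continuous F := hF.continuous
  have hone : (1 : WithTop ℕ∞) ≤ ∞ := ENat.LEInfty.out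
  have htwo : (2 : WithTop ℕ∞) ≤ ∞ := ENat.LEInfty.out
  set G : P × Model d → Model d := fun q => φ (F (q.1, φ.symm q.2)) with hG
  have hGc : ContDiffAt ℝ ∞ G (p₀, φ x₀) :=
    contDiffAt_localRep hF hφ hφ hy₀ (by rwa [h0, φ.left_inv hx₀])
  have hGp : ∀ᶠ y in 𝓝 (φ x₀), G (p₀, y) = y := by
    filter_upwards [φ.open_target.mem_nhds hy₀] with y hy
    simp [hG, h0, φ.right_inv hy]
  have hG0 : G (p₀, φ x₀) = φ x₀ := hGp.self_of_nhds
  set D := fderiv ℝ G (p₀, φ x₀) with hD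
  have hGd : HasFDerivAt G D (p₀, φ x₀) := (hGc.differentiableAt (by simp)).hasFDerivAt
  have hDs : D.comp (ContinuousLinearMap.inr ℝ P (Model d)) = ContinuousLinearMap.id ℝ (Model d) := by
    have h1 : HasFDerivAt (fun y => G (p₀, y)) (D.comp (ContinuousLinearMap.inr ℝ P (Model d)))
        (φ x₀) := hGd.comp (φ x₀) (hasFDerivAt_prodMk_right p₀ (φ x₀))
    exact h1.unique ((hasFDerivAt_id (φ x₀)).congr_of_eventuallyEq hGp)
  -- Keeping the parameter as a coordinate makes the differential block triangular with identity
  -- diagonal blocks, so one application of the inverse function theorem is uniform in the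
  -- parameter.
  set Φ : P × Model d → P × Model d := fun q => (q.1, G q) with hΦ
  let e : (P × Model d) ≃L[ℝ] (P × Model d) :=
    (ContinuousLinearEquiv.refl ℝ P).skewProd (ContinuousLinearEquiv.refl ℝ (Model d))
      (D.comp (ContinuousLinearMap.inl ℝ P (Model d)))
  have hΦs : HasStrictFDerivAt Φ (e : (P × Model d) →L[ℝ] (P × Model d)) (p₀, φ x₀) := by
    have h1 : HasStrictFDerivAt Φ ((ContinuousLinearMap.fst ℝ P (Model d)).prod D) (p₀, φ x₀) :=
      hasStrictFDerivAt_fst.prodMk (hGc.hasStrictFDerivAt' hGd (by simp))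
    convert! h1 using 1
    ext1
    · ext v <;> simp [e]
    · ext v
      · simp [e]
      · have := congrArg (fun L : Model d →L[ℝ] Model d => L v) hDs
        simp only [ContinuousLinearMap.comp_apply, ContinuousLinearMap.inr_apply,
          ContinuousLinearMap.id_apply] at this
        have h00 : D ((0 : P), (0 : Model d)) = 0 := D.map_zero
        simp [e, this, h00]
  have hΦ0 : Φ (p₀, φ x₀) = (p₀, φ x₀) := by simp [hΦ, hG0]
  have hφt : Tendsto (fun q : P × M => (q.1, φ q.2)) (𝓝 (p₀, x₀)) (𝓝 (p₀, φ x₀)) :=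
    (continuousAt_fst.prodMk ((φ.continuousAt hx₀).comp continuousAt_snd)).tendsto
  have hsc : ContinuousAt (fun q : P × Model d => F (q.1, φ.symm q.2)) (p₀, φ x₀) :=
    hFc.continuousAt.comp (continuousAt_fst.prodMk
      (ContinuousAt.comp (g := φ.symm) (f := Prod.snd) (x := (p₀, φ x₀))
        (φ.continuousAt_symm hy₀) continuousAt_snd))
  have hgood : ∀ᶠ q : P × Model d in 𝓝 (p₀, φ x₀), q.2 ∈ φ.target ∧
      F (q.1, φ.symm q.2) ∈ φ.source :=
    (continuousAt_snd.eventually (φ.open_target.mem_nhds hy₀)).and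
      (hsc.eventually (φ.open_source.mem_nhds
        (show F (p₀, φ.symm (φ x₀)) ∈ φ.source by rwa [h0, φ.left_inv hx₀])))
  refine ⟨?_, ?_, ?_⟩
  · have h1 : ∀ᶠ z in 𝓝 (p₀, φ x₀), ∃ q, Φ q = z ∧ q.2 ∈ φ.target ∧
        F (q.1, φ.symm q.2) ∈ φ.source := by
      have h2 := image_mem_map (m := Φ) hgood
      rw [hΦs.map_nhds_eq_of_equiv, hΦ0] at h2
      filter_upwards [h2] with z hz
      obtain ⟨q, hq, rfl⟩ := hz
      exact ⟨q, rfl, hq⟩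
    filter_upwards [hφt.eventually h1, continuousAt_snd.eventually (φ.open_source.mem_nhds hx₀)]
      with ⟨p, x⟩ ⟨⟨p', y⟩, hq, _, hqs⟩ hx
    simp only [hΦ, hG, Prod.mk.injEq] at hq
    obtain ⟨rfl, hq⟩ := hq
    exact ⟨φ.symm y, φ.injOn hqs hx hq⟩
  · set h := hΦs.toOpenPartialHomeomorph Φ
    have hU : h.source ∈ 𝓝 (p₀, φ x₀) :=
      h.open_source.mem_nhds hΦs.mem_toOpenPartialHomeomorph_source
    have t1 : Tendsto (fun q : P × (M × M) => (q.1, q.2.1)) (𝓝 (p₀, (x₀, x₀))) (𝓝 (p₀, x₀)) :=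
      (continuousAt_fst.prodMk (continuousAt_fst.comp continuousAt_snd)).tendsto
    have t2 : Tendsto (fun q : P × (M × M) => (q.1, q.2.2)) (𝓝 (p₀, (x₀, x₀))) (𝓝 (p₀, x₀)) :=
      (continuousAt_fst.prodMk (continuousAt_snd.comp continuousAt_snd)).tendsto
    have hs : ∀ᶠ q : P × M in 𝓝 (p₀, x₀), q.2 ∈ φ.source :=
      continuousAt_snd.eventually (φ.open_source.mem_nhds hx₀)
    filter_upwards [(hφt.comp t1).eventually hU, (hφt.comp t2).eventually hU, t1.eventually hs,
      t2.eventually hs] with ⟨p, x, x'⟩ ha hb hx hx' hxx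
    have : Φ (p, φ x) = Φ (p, φ x') := by
      simp only [hΦ, hG, φ.left_inv hx, φ.left_inv hx']
      exact congrArg (fun z => (p, φ z)) hxx
    have h3 := h.injOn ha hb this
    exact φ.injOn hx hx' (congrArg Prod.snd h3)
  · have hc : ContinuousAt (fun q : P × Model d => (fderiv ℝ G q).comp
        (ContinuousLinearMap.inr ℝ P (Model d))) (p₀, φ x₀) :=
      ((hGc.fderiv_right (m := 1) (by rw [one_add_one_eq_two]; exact htwo)).continuousAt).clm_comp
        continuousAt_const
    -- The differential of the slice is the identity at the base point, and the invertible operators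
    -- form a neighbourhood of it.
    have hr : range ((↑) : (Model d ≃L[ℝ] Model d) → (Model d →L[ℝ] Model d)) ∈
        𝓝 ((fderiv ℝ G (p₀, φ x₀)).comp (ContinuousLinearMap.inr ℝ P (Model d))) := by
      have h2 := ContinuousLinearEquiv.nhds (ContinuousLinearEquiv.refl ℝ (Model d))
      have h3 : ((ContinuousLinearEquiv.refl ℝ (Model d) : Model d ≃L[ℝ] Model d) :
        Model d →L[ℝ] Model d) = ContinuousLinearMap.id ℝ (Model d) := rfl
      rw [h3, ← hDs] at h2
      exact h2
    have hd : ∀ᶠ q in 𝓝 (p₀, φ x₀), ContDiffAt ℝ 1 G q := (hGc.of_le hone).eventually (by simp)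
    filter_upwards [hφt.eventually (hc.eventually hr), hφt.eventually hd, hφt.eventually hgood,
      continuousAt_snd.eventually (φ.open_source.mem_nhds hx₀)] with ⟨p, x⟩ ⟨e', he'⟩ hdx hgx hx
    refine ⟨φ, hφ, hx, ?_, e', ?_⟩
    · have := hgx.2
      simp only at this
      rwa [φ.left_inv hx] at this
    · have h4 := (hdx.differentiableAt (by simp)).hasFDerivAt
      have h5 := h4.comp (φ x) (hasFDerivAt_prodMk_right p (φ x))
      rw [he']
      exact h5

/-- A smooth family of self-maps of a compact manifold consists of diffeomorphisms near a
parameter where it is the identity. -/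
theorem eventually_exists_diff [CompactSpace M] [T2Space M] {F : P × M → M}
    (hF : ContMDiff (𝓘(ℝ, P).prod (𝓡 d)) (𝓡 d) ∞ F) {p₀ : P} (h0 : ∀ x, F (p₀, x) = x) :
    ∀ᶠ p in 𝓝 p₀, ∃ g : Diff d M, ∀ x, g x = F (p, x) := by
  have hFc : Continuous F := hF.continuous
  have hsurj : ∀ᶠ p in 𝓝 p₀, ∀ y ∈ (univ : Set M), ∃ x, F (p, x) = y :=
    isCompact_univ.eventually_forall_of_forall_eventually fun x _ =>
      (eventually_local_of_eq_id hF h0 x).1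
  have hder : ∀ᶠ p in 𝓝 p₀, ∀ x ∈ (univ : Set M), ∃ φ ∈ IsManifold.maximalAtlas (𝓡 d) ∞ M,
      x ∈ φ.source ∧ F (p, x) ∈ φ.source ∧ ∃ e : Model d ≃L[ℝ] Model d,
        HasFDerivAt (φ ∘ (fun x => F (p, x)) ∘ φ.symm) (e : Model d →L[ℝ] Model d) (φ x) :=
    isCompact_univ.eventually_forall_of_forall_eventually fun x _ =>
      (eventually_local_of_eq_id hF h0 x).2.2
  -- Compactness of `M × M`: local injectivity applies near the diagonal, and the Hausdorff property
  -- keeps the images apart elsewhere.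
  have hinj : ∀ᶠ p in 𝓝 p₀, ∀ z ∈ (univ : Set (M × M)), F (p, z.1) = F (p, z.2) → z.1 = z.2 := by
    refine isCompact_univ.eventually_forall_of_forall_eventually ?_
    rintro ⟨x, y⟩ -
    by_cases hxy : x = y
    · subst hxy
      exact (eventually_local_of_eq_id hF h0 x).2.1
    · have hc : ContinuousAt (fun q : P × (M × M) => (F (q.1, q.2.1), F (q.1, q.2.2)))
          (p₀, (x, y)) := by fun_prop
      have hne : {z : M × M | z.1 ≠ z.2} ∈ 𝓝 (F (p₀, x), F (p₀, y)) := by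
        refine (isOpen_ne_fun continuous_fst continuous_snd).mem_nhds ?_
        simpa [h0] using hxy
      filter_upwards [hc.eventually hne] with q hq h
      exact absurd h hq
  filter_upwards [hsurj, hder, hinj] with p hs hd hi
  have hFp : ContMDiff (𝓡 d) (𝓡 d) ∞ (fun x => F (p, x)) :=
    hF.comp (contMDiff_const.prodMk contMDiff_id)
  obtain ⟨g, hg⟩ := exists_diff_of_bijective hFp
    ⟨fun x y h => hi (x, y) (mem_univ _) h, fun y => hs y (mem_univ _)⟩ (fun x => hd x (mem_univ _))
  exact ⟨g, fun x => congrFun hg x⟩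

end NearIdentity



/-! ### Continuity in the `C^∞` topology -/

section SmoothTopology

/-- The iterated derivatives of a smooth family depend smoothly on the parameter and the point. -/
theorem contDiffAt_iteratedFDeriv_param {P E E' : Type*} [NormedAddCommGroup P] [NormedSpace ℝ P]
    [NormedAddCommGroup E] [NormedSpace ℝ E] [NormedAddCommGroup E'] [NormedSpace ℝ E']
    {G : P × E → E'} {q₀ : P × E} (hG : ContDiffAt ℝ ∞ G q₀) (k : ℕ) :
    ContDiffAt ℝ ∞ (fun q : P × E => iteratedFDeriv ℝ k (fun y => G (q.1, y)) q.2) q₀ := by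
  induction k with
  | zero =>
    simp only [iteratedFDeriv_zero_eq_comp, Function.comp_def]
    exact (continuousMultilinearCurryFin0 ℝ E E').symm.contDiff.contDiffAt.comp q₀ hG
  | succ k ih =>
    simp only [iteratedFDeriv_succ_eq_comp_left, Function.comp_def]
    have hL : ContDiff ℝ ∞ (continuousMultilinearCurryLeftEquiv ℝ (fun _ : Fin (k + 1) => E) E').symm :=
      LinearIsometryEquiv.contDiff (𝕜 := ℝ) (E := E →L[ℝ] E [×k]→L[ℝ] E')
        (F := E [×(k + 1)]→L[ℝ] E') _
    refine hL.contDiffAt.comp q₀ ?_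
    refine ContDiffAt.fderiv (n := ∞)
      (f := fun (q : P × E) (y : E) => iteratedFDeriv ℝ k (fun y => G (q.1, y)) y) (g := Prod.snd)
      ?_ contDiffAt_snd (by simp)
    exact ContDiffAt.comp (q₀, q₀.2) (f := fun z : (P × E) × E => (z.1.1, z.2))
      (g := fun q : P × E => iteratedFDeriv ℝ k (fun y => G (q.1, y)) q.2) ih
      (contDiffAt_fst.fst.prodMk contDiffAt_snd)

variable {d : ℕ} {M : Type*} [TopologicalSpace M] [ChartedSpace (Model d) M]
  {P : Type*} [NormedAddCommGroup P] [NormedSpace ℝ P]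

/-- A smooth family of diffeomorphisms is continuous in the `C^∞` topology. -/
theorem continuousOn_diff_of_contMDiff {F : P × M → M}
    (hF : ContMDiff (𝓘(ℝ, P).prod (𝓡 d)) (𝓡 d) ∞ F) {S : Set P} {g : P → Diff d M}
    (hg : ∀ p ∈ S, ∀ x, g p x = F (p, x)) : ContinuousOn g S := by
  have hFc : Continuous F := hF.continuous
  rw [continuousOn_iff_continuous_domRestrict]
  refine continuous_generateFrom_iff.2 ?_
  rintro _ ⟨f, φ, ψ, K, r, ε, hφ, hψ, hK, hKφ, hKf, hε, rfl⟩
  rw [isOpen_iff_mem_nhds]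
  rintro ⟨p₀, hp₀⟩ ⟨hmaps, hder⟩
  have hgF : ∀ p ∈ S, ψ ∘ g p ∘ φ.symm = fun y => ψ (F (p, φ.symm y)) := by
    intro p hp
    funext y
    simp [hg p hp]
  simp only [domRestrict_apply] at hmaps hder
  -- The derivatives are jointly continuous in the parameter and the point, so the strict
  -- inequalities persist near `(p₀, x)`; compactness of `K` then makes them uniform in the point.
  have hloc : ∀ x ∈ K, ∀ᶠ q : P × M in 𝓝 (p₀, x), F q ∈ ψ.source ∧ (q.2 ∈ K →
      ∀ k ∈ Finset.range (r + 1), ‖iteratedFDeriv ℝ k (fun y => ψ (F (q.1, φ.symm y))) (φ q.2) -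
        iteratedFDeriv ℝ k (ψ ∘ f ∘ φ.symm) (φ q.2)‖ < ε) := by
    intro x hx
    have hxφ : x ∈ φ.source := hKφ hx
    have hs0 : F (p₀, x) ∈ ψ.source := by
      have := hmaps hx
      rwa [hg p₀ hp₀] at this
    have h1 : ∀ᶠ q : P × M in 𝓝 (p₀, x), F q ∈ ψ.source :=
      hFc.continuousAt.eventually (ψ.open_source.mem_nhds hs0)
    have h2 : ∀ k ∈ Finset.range (r + 1), ∀ᶠ q : P × M in 𝓝 (p₀, x),
        ‖iteratedFDeriv ℝ k (fun y => ψ (F (q.1, φ.symm y))) (φ q.2) -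
          iteratedFDeriv ℝ k (ψ ∘ f ∘ φ.symm) (φ q.2)‖ < ε := by
      intro k hk
      have hG : ContDiffAt ℝ ∞ (fun q : P × Model d => ψ (F (q.1, φ.symm q.2))) (p₀, φ x) :=
        contDiffAt_localRep hF hφ hψ (φ.map_source hxφ) (by rwa [φ.left_inv hxφ])
      have hf : ContDiffAt ℝ ∞ (ψ ∘ f ∘ φ.symm) (φ x) := by
        have h3 : ContMDiffAt 𝓘(ℝ, Model d) (𝓡 d) ∞ φ.symm (φ x) :=
          (contMDiffOn_symm_of_mem_maximalAtlas hφ).contMDiffAt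
            (φ.open_target.mem_nhds (φ.map_source hxφ))
        have h5 := ContMDiffAt.comp (φ x) (f.contMDiff (φ.symm (φ x))) h3
        have h6 := ContMDiffAt.comp (φ x) (I'' := 𝓘(ℝ, Model d))
          (contMDiffAt_of_mem_maximalAtlas hψ (show f (φ.symm (φ x)) ∈ ψ.source by
            rw [φ.left_inv hxφ]; exact hKf hx)) h5
        exact contMDiffAt_iff_contDiffAt.1 h6
      have hφc : ContinuousAt (fun q : P × M => (q.1, φ q.2)) (p₀, x) :=
        continuousAt_fst.prodMk (ContinuousAt.comp (g := φ) (f := Prod.snd) (x := (p₀, x))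
          (φ.continuousAt hxφ) continuousAt_snd)
      have hfc : ContinuousAt (iteratedFDeriv ℝ k (ψ ∘ f ∘ φ.symm)) (φ x) :=
        (hf.iteratedFDeriv_right (m := 0) (i := k) (by
          rw [zero_add]; exact ENat.LEInfty.out)).continuousAt
      have hc1 : ContinuousAt (fun q : P × M =>
          iteratedFDeriv ℝ k (fun y => ψ (F (q.1, φ.symm y))) (φ q.2)) (p₀, x) :=
        ContinuousAt.comp (x := (p₀, x)) (f := fun q : P × M => (q.1, φ q.2))
          (g := fun q : P × Model d => iteratedFDeriv ℝ k (fun y => ψ (F (q.1, φ.symm y))) q.2)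
          (contDiffAt_iteratedFDeriv_param hG k).continuousAt hφc
      have hc2 : ContinuousAt (fun q : P × M => iteratedFDeriv ℝ k (ψ ∘ f ∘ φ.symm) (φ q.2))
          (p₀, x) :=
        ContinuousAt.comp (x := (p₀, x)) (f := fun q : P × M => φ q.2)
          (g := iteratedFDeriv ℝ k (ψ ∘ f ∘ φ.symm)) hfc hφc.snd
      refine (hc1.sub hc2).norm.eventually_lt continuousAt_const ?_
      have := hder k (by simpa [Nat.lt_succ_iff] using hk) x hx
      rwa [hgF p₀ hp₀] at this
    filter_upwards [h1, (Filter.eventually_all_finset _).2 h2] with q hq1 hq2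
    exact ⟨hq1, fun _ => hq2⟩
  have hev := hK.eventually_forall_of_forall_eventually (x₀ := p₀)
    (P := fun p x => F (p, x) ∈ ψ.source ∧ (x ∈ K →
      ∀ k ∈ Finset.range (r + 1), ‖iteratedFDeriv ℝ k (fun y => ψ (F (p, φ.symm y))) (φ x) -
        iteratedFDeriv ℝ k (ψ ∘ f ∘ φ.symm) (φ x)‖ < ε)) hloc
  filter_upwards [continuousAt_subtype_val.eventually hev] with ⟨p, hp⟩ h
  refine ⟨fun x hx => ?_, fun k hk x hx => ?_⟩
  · simp only [domRestrict_apply, hg p hp]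
    exact (h x hx).1
  · simp only [domRestrict_apply, hgF p hp]
    exact (h x hx).2 hx k (by simpa [Nat.lt_succ_iff] using hk)

end SmoothTopology



/-! ### A finite-dimensional family of self-maps spanning all tangent directions -/

section Spray

/-- A smooth map of a Euclidean space into the ball of radius `δ` around `0`. -/
def squeeze {d : ℕ} (δ : ℝ) (v : Model d) : Model d := (δ / (1 + ‖v‖ ^ 2)) • v

theorem contDiff_squeeze {d : ℕ} (δ : ℝ) : ContDiff ℝ ∞ (squeeze (d := d) δ) :=
  (contDiff_const.div (contDiff_const.add (contDiff_norm_sq ℝ)) fun v => by positivity).smul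
    contDiff_id

theorem norm_squeeze_lt {d : ℕ} {δ : ℝ} (hδ : 0 < δ) (v : Model d) : ‖squeeze δ v‖ < δ := by
  have h : 0 < 1 + ‖v‖ ^ 2 := by positivity
  rw [squeeze, norm_smul, Real.norm_eq_abs, abs_of_pos (by positivity), div_mul_eq_mul_div,
    div_lt_iff₀ h]
  exact mul_lt_mul_of_pos_left (by nlinarith [sq_nonneg (‖v‖ - 1)]) hδ

/-- At `0` the differential of `squeeze δ` is multiplication by `δ`, so for `δ ≠ 0` no direction is
lost; the variation of the scalar factor is multiplied by `0 • w`. -/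
theorem hasDerivAt_squeeze_line {d : ℕ} (δ : ℝ) (w : Model d) :
    HasDerivAt (fun σ : ℝ => squeeze δ (σ • w)) (δ • w) 0 := by
  have h1 : DifferentiableAt ℝ (fun σ : ℝ => δ / (1 + ‖σ • w‖ ^ 2)) 0 := by
    have : (fun σ : ℝ => δ / (1 + ‖σ • w‖ ^ 2)) = fun σ => δ / (1 + σ ^ 2 * ‖w‖ ^ 2) := by
      funext σ
      rw [norm_smul, mul_pow, Real.norm_eq_abs, sq_abs]
    rw [this]
    exact (differentiableAt_const δ).div (by fun_prop) (by norm_num)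
  have h2 : HasDerivAt (fun σ : ℝ => σ • w) ((1 : ℝ) • w) 0 := (hasDerivAt_id (0 : ℝ)).smul_const w
  have h3 : HasDerivAt (fun σ : ℝ => squeeze δ (σ • w)) _ 0 := h1.hasDerivAt.smul h2
  convert h3 using 1
  simp

variable {d : ℕ} {M : Type*} [TopologicalSpace M] [ChartedSpace (Model d) M]

/-- The velocity at time `0` of a curve, as a vector of the model space. -/
def velocityZero (γ : ℝ → M) : Model d := mfderiv 𝓘(ℝ, ℝ) (𝓡 d) γ 0 (1 : ℝ)

variable  [IsManifold (𝓡 d) ∞ M] [T2Space M]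

/-- Cut-off translations in the chart at `c`. -/
theorem exists_chart_translation (c : M) : ∃ T : Model d × M → M,
    ContMDiff (𝓘(ℝ, Model d).prod (𝓡 d)) (𝓡 d) ∞ T ∧ (∀ x, T (0, x) = x) ∧
    ∀ᶠ x in 𝓝 c, ∀ v : Model d, ∃ w : Model d,
      velocityZero (d := d) (fun σ : ℝ => T (σ • w, x)) = v := by
  classical
  set φ := chartAt (Model d) c with hφdef
  have hφ : φ ∈ IsManifold.maximalAtlas (𝓡 d) ∞ M := IsManifold.chart_mem_maximalAtlas _
  obtain ⟨f⟩ : Nonempty (SmoothBumpFunction (𝓡 d) c) := inferInstance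
  have hts : tsupport f ⊆ φ.source := f.tsupport_subset_chartAt_source
  have hK : IsCompact (φ '' tsupport f) :=
    f.hasCompactSupport.isCompact.image_of_continuousOn (φ.continuousOn.mono hts)
  obtain ⟨δ, hδ, hδK⟩ := hK.exists_thickening_subset_open φ.open_target
    (by rintro _ ⟨x, hx, rfl⟩; exact φ.map_source (hts hx))
  have hmem : ∀ x ∈ tsupport f, ∀ v, φ x + f x • squeeze δ v ∈ φ.target := by
    intro x hx v
    refine hδK (Metric.mem_thickening_iff.2 ⟨φ x, mem_image_of_mem _ hx, ?_⟩)
    rw [dist_eq_norm, add_sub_cancel_left, norm_smul, Real.norm_eq_abs, abs_of_nonneg f.nonneg]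
    calc f x * ‖squeeze δ v‖ ≤ 1 * ‖squeeze δ v‖ :=
          mul_le_mul_of_nonneg_right f.le_one (norm_nonneg _)
      _ < δ := by rw [one_mul]; exact norm_squeeze_lt hδ v
  let T : Model d × M → M := fun q =>
    if q.2 ∈ φ.source then φ.symm (φ q.2 + f q.2 • squeeze δ q.1) else q.2
  have hT : ∀ q : Model d × M, q.2 ∈ φ.source → T q = φ.symm (φ q.2 + f q.2 • squeeze δ q.1) :=
    fun q hq => if_pos hq
  have hT0 : ∀ q : Model d × M, f q.2 = 0 → T q = q.2 := by
    intro q hq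
    by_cases h : q.2 ∈ φ.source
    · rw [hT q h, hq, zero_smul, add_zero, φ.left_inv h]
    · exact if_neg h
  refine ⟨T, ?_, ?_, ?_⟩
  · rintro ⟨v₀, x₀⟩
    by_cases hx : x₀ ∈ tsupport f
    · have h1 : ContMDiffAt (𝓘(ℝ, Model d).prod (𝓡 d)) 𝓘(ℝ, Model d) ∞
          (fun q : Model d × M => φ q.2 + f q.2 • squeeze δ q.1) (v₀, x₀) := by
        have a1 : ContMDiffAt (𝓘(ℝ, Model d).prod (𝓡 d)) 𝓘(ℝ, Model d) ∞
            (fun q : Model d × M => φ q.2) (v₀, x₀) :=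
          ContMDiffAt.comp (v₀, x₀) (contMDiffAt_of_mem_maximalAtlas hφ (hts hx)) contMDiffAt_snd
        have a2 : ContMDiffAt (𝓘(ℝ, Model d).prod (𝓡 d)) 𝓘(ℝ, ℝ) ∞
            (fun q : Model d × M => f q.2) (v₀, x₀) :=
          ContMDiffAt.comp (v₀, x₀) f.contMDiff.contMDiffAt contMDiffAt_snd
        have a3 : ContMDiffAt (𝓘(ℝ, Model d).prod (𝓡 d)) 𝓘(ℝ, Model d) ∞
            (fun q : Model d × M => squeeze δ q.1) (v₀, x₀) :=
          ContMDiffAt.comp (v₀, x₀) (g := squeeze δ) (f := Prod.fst)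
            (contDiff_squeeze δ).contMDiff.contMDiffAt contMDiffAt_fst
        exact a1.add (a2.smul a3)
      have h2 : ContMDiffAt 𝓘(ℝ, Model d) (𝓡 d) ∞ φ.symm (φ x₀ + f x₀ • squeeze δ v₀) :=
        (contMDiffOn_symm_of_mem_maximalAtlas hφ).contMDiffAt
          (φ.open_target.mem_nhds (hmem x₀ hx v₀))
      refine (ContMDiffAt.comp (v₀, x₀) h2 h1).congr_of_eventuallyEq ?_
      filter_upwards [continuousAt_snd.eventually (φ.open_source.mem_nhds (hts hx))] with q hq
      exact hT q hq
    · refine (contMDiffAt_snd (n := ∞)).congr_of_eventuallyEq ?_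
      filter_upwards [continuousAt_snd.eventually
        ((isClosed_tsupport f).isOpen_compl.mem_nhds hx)] with q hq
      exact hT0 q (image_eq_zero_of_notMem_tsupport hq)
  · intro x
    by_cases h : x ∈ φ.source
    · rw [hT _ h]
      simp [squeeze, φ.left_inv h]
    · exact if_neg h
  · filter_upwards [f.eventuallyEq_one, φ.open_source.mem_nhds (mem_chart_source _ c)]
      with x hx hxs v
    have hder := mdifferentiable_chart (I := 𝓡 d) c
    have hinv := hder.symm_comp_deriv (x := x) hxs
    let u : Model d := mfderiv (𝓡 d) (𝓡 d) φ x v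
    -- Near `c` the bump equals `1`, so only the factor `δ` of `squeeze` has to be undone.
    obtain ⟨w, hw⟩ : ∃ w : Model d, δ • w = u := ⟨δ⁻¹ • u, smul_inv_smul₀ hδ.ne' u⟩
    refine ⟨w, ?_⟩
    have hcurve : HasFDerivAt (fun σ : ℝ => φ x + squeeze δ (σ • w))
        (ContinuousLinearMap.toSpanSingleton ℝ (δ • w)) 0 :=
      ((hasDerivAt_squeeze_line δ w).const_add (φ x)).hasFDerivAt
    have hc0 : φ x + squeeze δ ((0 : ℝ) • w) = φ x := by simp [squeeze]
    have hsymm : HasMFDerivAt 𝓘(ℝ, Model d) (𝓡 d) φ.symm (φ x + squeeze δ ((0 : ℝ) • w))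
        (mfderiv 𝓘(ℝ, Model d) (𝓡 d) φ.symm (φ x)) := by
      rw [hc0]
      exact (hder.mdifferentiableAt_symm (φ.map_source hxs)).hasMFDerivAt
    have hcomp := (HasMFDerivAt.comp (0 : ℝ) hsymm hcurve.hasMFDerivAt).mfderiv
    have hfun : (fun σ : ℝ => T (σ • w, x)) = φ.symm ∘ fun σ : ℝ => φ x + squeeze δ (σ • w) := by
      funext σ
      rw [hT _ hxs]
      simp [hx]
    rw [hfun]
    refine (congrArg (fun L : ℝ →L[ℝ] Model d => L 1) hcomp).trans ?_
    have h1 : (mfderiv 𝓘(ℝ, Model d) (𝓡 d) φ.symm (φ x) : Model d →L[ℝ] Model d)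
        ((1 : ℝ) • (δ • w)) = v := by
      rw [one_smul, hw]
      exact congrArg (fun L : Model d →L[ℝ] Model d => L v) hinv
    exact h1

/-- On a compact manifold there is a smooth finite-dimensional family of self-maps through the
identity whose infinitesimal variations span every tangent space. -/
theorem exists_spray [CompactSpace M] : ∃ (ι : Type) (_ : Fintype ι) (E : (ι → ℝ) × M → M),
    ContMDiff (𝓘(ℝ, ι → ℝ).prod (𝓡 d)) (𝓡 d) ∞ E ∧ (∀ x, E (0, x) = x) ∧
    ∀ (x : M) (v : Model d), ∃ w : ι → ℝ,
      velocityZero (d := d) (fun σ : ℝ => E (σ • w, x)) = v := by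
  suffices h : ∃ (ι : Type) (_ : Fintype ι) (E : (ι → ℝ) × M → M),
      ContMDiff (𝓘(ℝ, ι → ℝ).prod (𝓡 d)) (𝓡 d) ∞ E ∧ (∀ x, E (0, x) = x) ∧
      ∀ x ∈ (univ : Set M), ∀ v : Model d, ∃ w : ι → ℝ,
        velocityZero (d := d) (fun σ : ℝ => E (σ • w, x)) = v by
    obtain ⟨ι, hι, E, h1, h2, h3⟩ := h
    exact ⟨ι, hι, E, h1, h2, fun x => h3 x (mem_univ x)⟩
  refine isCompact_univ.induction_on ?_ ?_ ?_ ?_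
  · exact ⟨Empty, inferInstance, Prod.snd, contMDiff_snd, fun _ => rfl, by simp⟩
  · rintro s t hst ⟨ι, hι, E, h1, h2, h3⟩
    exact ⟨ι, hι, E, h1, h2, fun x hx => h3 x (hst hx)⟩
  · rintro s t ⟨ι, hι, E, h1, h2, h3⟩ ⟨ι', hι', E', h1', h2', h3'⟩
    let L : (ι ⊕ ι' → ℝ) →L[ℝ] (ι → ℝ) :=
      ContinuousLinearMap.pi fun i => ContinuousLinearMap.proj (Sum.inl i)
    let L' : (ι ⊕ ι' → ℝ) →L[ℝ] (ι' → ℝ) :=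
      ContinuousLinearMap.pi fun i => ContinuousLinearMap.proj (Sum.inr i)
    -- Composing the two families works because either one reduces to the identity when its own
    -- parameters vanish, leaving the variations of the other.
    refine ⟨ι ⊕ ι', inferInstance, fun q => E (L q.1, E' (L' q.1, q.2)), ?_, ?_, ?_⟩
    · exact h1.comp ((L.contMDiff.comp contMDiff_fst).prodMk
        (h1'.comp ((L'.contMDiff.comp contMDiff_fst).prodMk contMDiff_snd)))
    · intro x
      simp [h2, h2']
    · rintro x (hx | hx) v
      · obtain ⟨w, hw⟩ := h3 x hx v
        refine ⟨Sum.elim w 0, ?_⟩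
        have e : (fun σ : ℝ => E (L (σ • Sum.elim w 0), E' (L' (σ • Sum.elim w 0), x))) =
            fun σ : ℝ => E (σ • w, x) := by
          funext σ
          have e1 : L (Sum.elim w 0) = w := by ext i; simp [L]
          have e2 : L' (Sum.elim w 0) = 0 := by ext i; simp [L']
          rw [map_smul, map_smul, e1, e2, smul_zero, h2']
        exact (congrArg velocityZero e).trans hw
      · obtain ⟨w, hw⟩ := h3' x hx v
        refine ⟨Sum.elim 0 w, ?_⟩
        have e : (fun σ : ℝ => E (L (σ • Sum.elim (0 : ι → ℝ) w), E' (L' (σ • Sum.elim (0 : ι → ℝ) w), x))) =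
            fun σ : ℝ => E' (σ • w, x) := by
          funext σ
          have e1 : L (Sum.elim (0 : ι → ℝ) w) = 0 := by ext i; simp [L]
          have e2 : L' (Sum.elim (0 : ι → ℝ) w) = w := by ext i; simp [L']
          rw [map_smul, map_smul, e1, e2, smul_zero, h2]
        exact (congrArg velocityZero e).trans hw
  · intro c _
    obtain ⟨T, h1, h2, h3⟩ := exists_chart_translation (d := d) c
    let L := EuclideanSpace.equiv (Fin d) ℝ
    refine ⟨_, mem_nhdsWithin_of_mem_nhds h3, Fin d, inferInstance,
      fun q => T (L.symm q.1, q.2), ?_, ?_, ?_⟩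
    · exact h1.comp ((L.symm.contDiff.contMDiff.comp contMDiff_fst).prodMk contMDiff_snd)
    · intro x
      simp [h2]
    · intro x hx v
      obtain ⟨w, hw⟩ := hx v
      refine ⟨L w, ?_⟩
      have e : (fun σ : ℝ => T (L.symm (σ • L w), x)) = fun σ : ℝ => T (σ • w, x) := by
        funext σ
        rw [map_smul, L.symm_apply_apply]
      exact (congrArg velocityZero e).trans hw

end Spray



/-! ### Means and periodic primitives of trigonometric products -/

section PeriodicPrimitive

/-- `f - c` has a smooth `1`-periodic primitive. -/
def HasPeriodicPrimitive (f : ℝ → ℝ) (c : ℝ) : Prop :=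
  ∃ G : ℝ → ℝ, ContDiff ℝ ∞ G ∧ (∀ t, G (t + 1) = G t) ∧ ∀ t, HasDerivAt G (f t - c) t

theorem HasPeriodicPrimitive.linear_comb {f g : ℝ → ℝ} {c e : ℝ} (hf : HasPeriodicPrimitive f c)
    (hg : HasPeriodicPrimitive g e) (p q : ℝ) :
    HasPeriodicPrimitive (fun t => p * f t + q * g t) (p * c + q * e) := by
  obtain ⟨F, hF, hFp, hFd⟩ := hf
  obtain ⟨G, hG, hGp, hGd⟩ := hg
  refine ⟨fun t => p * F t + q * G t, (contDiff_const.mul hF).add (contDiff_const.mul hG),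
    fun t => by simp only [hFp, hGp], fun t => ?_⟩
  convert! ((hFd t).const_mul p).add ((hGd t).const_mul q) using 1
  ring

theorem hasDerivAt_cos_freq (m t : ℝ) : HasDerivAt (fun t => Real.cos (2 * Real.pi * m * t))
    (-(2 * Real.pi * m) * Real.sin (2 * Real.pi * m * t)) t := by
  have h : HasDerivAt (fun t : ℝ => 2 * Real.pi * m * t) (2 * Real.pi * m) t := by
    simpa using (hasDerivAt_id t).const_mul (2 * Real.pi * m)
  convert! h.cos using 1
  ring

theorem hasDerivAt_sin_freq (m t : ℝ) : HasDerivAt (fun t => Real.sin (2 * Real.pi * m * t))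
    (2 * Real.pi * m * Real.cos (2 * Real.pi * m * t)) t := by
  have h : HasDerivAt (fun t : ℝ => 2 * Real.pi * m * t) (2 * Real.pi * m) t := by
    simpa using (hasDerivAt_id t).const_mul (2 * Real.pi * m)
  convert! h.sin using 1
  ring

theorem cos_freq_add_one (m : ℤ) (t : ℝ) :
    Real.cos (2 * Real.pi * m * (t + 1)) = Real.cos (2 * Real.pi * m * t) := by
  rw [← Real.cos_add_int_mul_two_pi (2 * Real.pi * m * t) m]
  congr 1
  ring

theorem sin_freq_add_one (m : ℤ) (t : ℝ) :
    Real.sin (2 * Real.pi * m * (t + 1)) = Real.sin (2 * Real.pi * m * t) := by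
  rw [← Real.sin_add_int_mul_two_pi (2 * Real.pi * m * t) m]
  congr 1
  ring

theorem contDiff_cos_freq (m : ℝ) : ContDiff ℝ ∞ (fun t => Real.cos (2 * Real.pi * m * t)) :=
  Real.contDiff_cos.comp (contDiff_const.mul contDiff_id)

theorem contDiff_sin_freq (m : ℝ) : ContDiff ℝ ∞ (fun t => Real.sin (2 * Real.pi * m * t)) :=
  Real.contDiff_sin.comp (contDiff_const.mul contDiff_id)

theorem hasPeriodicPrimitive_cos (m : ℤ) :
    HasPeriodicPrimitive (fun t => Real.cos (2 * Real.pi * m * t)) (if m = 0 then 1 else 0) := by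
  split_ifs with h
  · subst h
    exact ⟨fun _ => 0, contDiff_const, fun _ => rfl, fun t => by
      simpa using hasDerivAt_const t (0 : ℝ)⟩
  · have hm : (2 * Real.pi * m : ℝ) ≠ 0 := by
      have : (m : ℝ) ≠ 0 := by exact_mod_cast h
      have := Real.pi_ne_zero
      positivity
    refine ⟨fun t => (2 * Real.pi * m)⁻¹ * Real.sin (2 * Real.pi * m * t),
      contDiff_const.mul (contDiff_sin_freq m), fun t => by simp only [sin_freq_add_one], fun t => ?_⟩
    convert! (hasDerivAt_sin_freq m t).const_mul (2 * Real.pi * m : ℝ)⁻¹ using 1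
    rw [inv_mul_cancel_left₀ hm, sub_zero]

theorem hasPeriodicPrimitive_sin (m : ℤ) :
    HasPeriodicPrimitive (fun t => Real.sin (2 * Real.pi * m * t)) 0 := by
  by_cases h : m = 0
  · subst h
    exact ⟨fun _ => 0, contDiff_const, fun _ => rfl, fun t => by
      simpa using hasDerivAt_const t (0 : ℝ)⟩
  · have hm : (-(2 * Real.pi * m) : ℝ) ≠ 0 := by
      have : (m : ℝ) ≠ 0 := by exact_mod_cast h
      have := Real.pi_ne_zero
      simp only [ne_eq, neg_eq_zero]
      positivity
    refine ⟨fun t => (-(2 * Real.pi * m))⁻¹ * Real.cos (2 * Real.pi * m * t),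
      contDiff_const.mul (contDiff_cos_freq m), fun t => by simp only [cos_freq_add_one], fun t => ?_⟩
    convert! (hasDerivAt_cos_freq m t).const_mul (-(2 * Real.pi * m) : ℝ)⁻¹ using 1
    rw [inv_mul_cancel_left₀ hm, sub_zero]

variable {ι : Type*}

/-- Cosines and sines of frequencies `N k`. -/
def oscillation (N : ι → ℕ) : ι ⊕ ι → ℝ → ℝ
  | Sum.inl k => fun t => Real.cos (2 * Real.pi * (N k : ℤ) * t)
  | Sum.inr k => fun t => Real.sin (2 * Real.pi * (N k : ℤ) * t)

/-- The derivatives of `oscillation`. -/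
def oscillation' (N : ι → ℕ) : ι ⊕ ι → ℝ → ℝ
  | Sum.inl k => fun t => -(2 * Real.pi * (N k : ℤ)) * Real.sin (2 * Real.pi * (N k : ℤ) * t)
  | Sum.inr k => fun t => 2 * Real.pi * (N k : ℤ) * Real.cos (2 * Real.pi * (N k : ℤ) * t)

theorem contDiff_oscillation (N : ι → ℕ) (c : ι ⊕ ι) : ContDiff ℝ ∞ (oscillation N c) := by
  cases c
  · exact contDiff_cos_freq _
  · exact contDiff_sin_freq _

theorem hasDerivAt_oscillation (N : ι → ℕ) (c : ι ⊕ ι) (t : ℝ) :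
    HasDerivAt (oscillation N c) (oscillation' N c t) t := by
  cases c
  · exact hasDerivAt_cos_freq _ t
  · exact hasDerivAt_sin_freq _ t

theorem continuous_oscillation' (N : ι → ℕ) (c : ι ⊕ ι) : Continuous (oscillation' N c) := by
  cases c <;> simp only [oscillation'] <;> fun_prop

theorem oscillation_add_one (N : ι → ℕ) (c : ι ⊕ ι) (t : ℝ) :
    oscillation N c (t + 1) = oscillation N c t := by
  cases c
  · exact cos_freq_add_one _ t
  · exact sin_freq_add_one _ t

variable [DecidableEq ι]

/-- The mean over a period of `oscillation N c * oscillation' N e`. -/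
def oscillationMean (N : ι → ℕ) : ι ⊕ ι → ι ⊕ ι → ℝ
  | Sum.inl k, Sum.inr l => if k = l then Real.pi * N k else 0
  | Sum.inr k, Sum.inl l => if k = l then -(Real.pi * N k) else 0
  | _, _ => 0

/-- Product-to-sum formulas leave frequencies `N k ± N l`. A constant term can only come from a
cosine of frequency zero, that is, from `k = l` with one cosine and one sine index. -/
theorem hasPeriodicPrimitive_oscillation {N : ι → ℕ} (hN : Function.Injective N)
    (hpos : ∀ k, 0 < N k) (c e : ι ⊕ ι) :
    HasPeriodicPrimitive (fun t => oscillation N c t * oscillation' N e t)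
      (oscillationMean N c e) := by
  have hsum : ∀ k l, (N k : ℤ) + N l ≠ 0 := fun k l => by have := hpos k; omega
  have hdiff : ∀ k l, ((N k : ℤ) - N l = 0) ↔ k = l := fun k l => by
    rw [sub_eq_zero]
    exact_mod_cast hN.eq_iff
  rcases c with k | k <;> rcases e with l | l
  · convert! (hasPeriodicPrimitive_sin ((N k : ℤ) + N l)).linear_comb
      (hasPeriodicPrimitive_sin ((N k : ℤ) - N l)) (-(Real.pi * N l)) (Real.pi * N l) using 1
    · funext t
      simp only [oscillation, oscillation']
      push_cast
      rw [show 2 * Real.pi * ((N k : ℝ) + N l) * t = 2 * Real.pi * N k * t + 2 * Real.pi * N l * t by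
        ring, show 2 * Real.pi * ((N k : ℝ) - N l) * t = 2 * Real.pi * N k * t - 2 * Real.pi * N l * t
        by ring, Real.sin_add, Real.sin_sub]
      ring
    · simp [oscillationMean]
  · convert! (hasPeriodicPrimitive_cos ((N k : ℤ) + N l)).linear_comb
      (hasPeriodicPrimitive_cos ((N k : ℤ) - N l)) (Real.pi * N l) (Real.pi * N l) using 1
    · funext t
      simp only [oscillation, oscillation']
      push_cast
      rw [show 2 * Real.pi * ((N k : ℝ) + N l) * t = 2 * Real.pi * N k * t + 2 * Real.pi * N l * t by
        ring, show 2 * Real.pi * ((N k : ℝ) - N l) * t = 2 * Real.pi * N k * t - 2 * Real.pi * N l * t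
        by ring, Real.cos_add, Real.cos_sub]
      ring
    · rw [if_neg (hsum k l)]
      by_cases hkl : k = l
      · subst hkl; simp [oscillationMean]
      · rw [if_neg (by rwa [hdiff])]; simp [oscillationMean, hkl]
  · convert! (hasPeriodicPrimitive_cos ((N k : ℤ) + N l)).linear_comb
      (hasPeriodicPrimitive_cos ((N k : ℤ) - N l)) (Real.pi * N l) (-(Real.pi * N l)) using 1
    · funext t
      simp only [oscillation, oscillation']
      push_cast
      rw [show 2 * Real.pi * ((N k : ℝ) + N l) * t = 2 * Real.pi * N k * t + 2 * Real.pi * N l * t by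
        ring, show 2 * Real.pi * ((N k : ℝ) - N l) * t = 2 * Real.pi * N k * t - 2 * Real.pi * N l * t
        by ring, Real.cos_add, Real.cos_sub]
      ring
    · rw [if_neg (hsum k l)]
      by_cases hkl : k = l
      · subst hkl; simp [oscillationMean]
      · rw [if_neg (by rwa [hdiff])]; simp [oscillationMean, hkl]
  · convert! (hasPeriodicPrimitive_sin ((N k : ℤ) + N l)).linear_comb
      (hasPeriodicPrimitive_sin ((N k : ℤ) - N l)) (Real.pi * N l) (Real.pi * N l) using 1
    · funext t
      simp only [oscillation, oscillation']
      push_cast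
      rw [show 2 * Real.pi * ((N k : ℝ) + N l) * t = 2 * Real.pi * N k * t + 2 * Real.pi * N l * t by
        ring, show 2 * Real.pi * ((N k : ℝ) - N l) * t = 2 * Real.pi * N k * t - 2 * Real.pi * N l * t
        by ring, Real.sin_add, Real.sin_sub]
      ring
    · simp [oscillationMean]

/-- The matrix of means is antisymmetric, so only the skew part of `b` survives averaging; this is
where `dα` emerges from `D`. -/
theorem sum_oscillationMean [Fintype ι] (N : ι → ℕ) (b : ι ⊕ ι → ι ⊕ ι → ℝ) :
    ∑ c, ∑ e, oscillationMean N c e * b c e =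
      ∑ k, Real.pi * N k * (b (Sum.inl k) (Sum.inr k) - b (Sum.inr k) (Sum.inl k)) := by
  simp only [Fintype.sum_sum_type, oscillationMean, ite_mul, zero_mul, Finset.sum_ite_eq,
    Finset.mem_univ, if_true, Finset.sum_const_zero, zero_add, add_zero]
  rw [← Finset.sum_add_distrib]
  exact Finset.sum_congr rfl fun k _ => by ring

end PeriodicPrimitive



/-! ### Oscillating fields with positive second-order drift -/

section OscillatingFields

open Matrix in
/-- If `u ⬝ η = 0`, then `u` is a combination of the projections of the basis vectors to `η^⊥`. -/
theorem eq_sum_smul_proj {ι : Type*} [Fintype ι] [DecidableEq ι] (η u : ι → ℝ) (s : ℝ)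
    (hu : u ⬝ᵥ η = 0) :
    u = ∑ k, u k • ((Pi.single k 1 : ι → ℝ) - (s * η k) • η) := by
  have h1 : ∑ k, u k • (Pi.single k 1 : ι → ℝ) = u := by
    funext l
    simp [Finset.sum_apply, Pi.single_apply]
  -- The corrections add up to a multiple of `u ⬝ᵥ η = 0`, whatever `s` is.
  have h2 : ∑ k, u k • ((s * η k) • η) = 0 := by
    have : ∀ k, u k • ((s * η k) • η) = (u k * η k) • (s • η) := fun k => by
      rw [smul_smul, smul_smul]; congr 1; ring
    rw [Finset.sum_congr rfl fun k _ => this k, ← Finset.sum_smul]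
    have h3 : ∑ k, u k * η k = 0 := hu
    rw [h3, zero_smul]
  simp only [smul_sub, Finset.sum_sub_distrib, h1, h2, sub_zero]

variable {d : ℕ} {M : Type*} [TopologicalSpace M] [ChartedSpace (Model d) M]
  {ι : Type*} [Fintype ι]

open Matrix

theorem contMDiff_dotProduct {u w : M → ι → ℝ} (hu : ContMDiff (𝓡 d) 𝓘(ℝ, ι → ℝ) ∞ u)
    (hw : ContMDiff (𝓡 d) 𝓘(ℝ, ι → ℝ) ∞ w) :
    ContMDiff (𝓡 d) 𝓘(ℝ, ℝ) ∞ (fun x => u x ⬝ᵥ w x) :=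
  ContMDiff.sum fun k _ => (contMDiff_pi_space.1 hu k).mul (contMDiff_pi_space.1 hw k)

variable [DecidableEq ι]

theorem contMDiff_toBilin' {D : M → Matrix ι ι ℝ}
    (hD : ∀ j k, ContMDiff (𝓡 d) 𝓘(ℝ, ℝ) ∞ (fun x => D x j k))
    {u w : M → ι → ℝ} (hu : ContMDiff (𝓡 d) 𝓘(ℝ, ι → ℝ) ∞ u)
    (hw : ContMDiff (𝓡 d) 𝓘(ℝ, ι → ℝ) ∞ w) :
    ContMDiff (𝓡 d) 𝓘(ℝ, ℝ) ∞ (fun x => toBilin' (D x) (u x) (w x)) := by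
  simp only [toBilin'_apply]
  exact ContMDiff.sum fun i _ => ContMDiff.sum fun j _ =>
    ((contMDiff_pi_space.1 hu i).mul (hD i j)).mul (contMDiff_pi_space.1 hw j)

/-- Smooth fields in the kernel of `η` on which the skew part of `D` is positive. -/
theorem exists_kernel_frame {η : M → ι → ℝ} (hη : ContMDiff (𝓡 d) 𝓘(ℝ, ι → ℝ) ∞ η)
    {D : M → Matrix ι ι ℝ} (hD : ∀ j k, ContMDiff (𝓡 d) 𝓘(ℝ, ℝ) ∞ (fun x => D x j k))
    (hη0 : ∀ x, η x ≠ 0)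
    (hskew : ∀ x, ∃ u w, u ⬝ᵥ η x = 0 ∧ w ⬝ᵥ η x = 0 ∧ toBilin' (D x) u w ≠ toBilin' (D x) w u) :
    ∃ (a b : ι → M → ι → ℝ) (ν : M → ι → ℝ),
      (∀ k, ContMDiff (𝓡 d) 𝓘(ℝ, ι → ℝ) ∞ (a k)) ∧
      (∀ k, ContMDiff (𝓡 d) 𝓘(ℝ, ι → ℝ) ∞ (b k)) ∧
      ContMDiff (𝓡 d) 𝓘(ℝ, ι → ℝ) ∞ ν ∧ (∀ k x, a k x ⬝ᵥ η x = 0) ∧ (∀ k x, b k x ⬝ᵥ η x = 0) ∧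
      (∀ x, ν x ⬝ᵥ η x = 1) ∧
      (∀ k x, 0 ≤ toBilin' (D x) (a k x) (b k x) - toBilin' (D x) (b k x) (a k x)) ∧
      ∀ x, ∃ k, 0 < toBilin' (D x) (a k x) (b k x) - toBilin' (D x) (b k x) (a k x) := by
  have hS : ∀ x, η x ⬝ᵥ η x ≠ 0 := fun x h => hη0 x (dotProduct_self_eq_zero.1 h)
  have hSinv : ContMDiff (𝓡 d) 𝓘(ℝ, ℝ) ∞ (fun x => (η x ⬝ᵥ η x)⁻¹) :=
    (contMDiff_dotProduct hη hη).inv₀ hS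
  set a : ι → M → ι → ℝ := fun k x =>
    (Pi.single k 1 : ι → ℝ) - ((η x ⬝ᵥ η x)⁻¹ * η x k) • η x with ha
  set om : M → (ι → ℝ) → (ι → ℝ) → ℝ := fun x u w => toBilin' (D x) u w - toBilin' (D x) w u with hom
  -- Chosen so that `om x (a k x) (b k x)` is the sum of the squares of `om x (a k x) (a l x)`.
  set b : ι → M → ι → ℝ := fun k x => ∑ l, om x (a k x) (a l x) • a l x with hb
  have has : ∀ k, ContMDiff (𝓡 d) 𝓘(ℝ, ι → ℝ) ∞ (a k) := fun k =>
    contMDiff_const.sub ((hSinv.mul (contMDiff_pi_space.1 hη k)).smul hη)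
  have hbs : ∀ k, ContMDiff (𝓡 d) 𝓘(ℝ, ι → ℝ) ∞ (b k) := fun k =>
    ContMDiff.sum fun l _ => ((contMDiff_toBilin' hD (has k) (has l)).sub
      (contMDiff_toBilin' hD (has l) (has k))).smul (has l)
  have ha0 : ∀ k x, a k x ⬝ᵥ η x = 0 := by
    intro k x
    simp only [ha, sub_dotProduct, smul_dotProduct, single_one_dotProduct, smul_eq_mul]
    field_simp [hS x]
    ring
  have hb0 : ∀ k x, b k x ⬝ᵥ η x = 0 := by
    intro k x
    simp [hb, sum_dotProduct, smul_dotProduct, ha0]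
  have hpos : ∀ k x, toBilin' (D x) (a k x) (b k x) - toBilin' (D x) (b k x) (a k x) =
      ∑ l, om x (a k x) (a l x) ^ 2 := by
    intro k x
    simp only [hb, map_sum, map_smul, LinearMap.sum_apply, LinearMap.smul_apply, smul_eq_mul]
    rw [← Finset.sum_sub_distrib]
    refine Finset.sum_congr rfl fun l _ => ?_
    simp only [hom]
    ring
  refine ⟨a, b, fun x => (η x ⬝ᵥ η x)⁻¹ • η x, has, hbs, hSinv.smul hη, ha0, hb0, ?_, ?_, ?_⟩
  · intro x
    rw [smul_dotProduct, smul_eq_mul, inv_mul_cancel₀ (hS x)]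
  · intro k x
    rw [hpos]
    exact Finset.sum_nonneg fun l _ => sq_nonneg _
  · intro x
    by_contra! hcon
    -- If every sum of squares vanished, `om x` would vanish on the span of the `a k x`, which is
    -- the whole kernel of `η x`, against `hskew`.
    have hz : ∀ k l, om x (a k x) (a l x) = 0 := by
      intro k l
      have h1 := hcon k
      rw [hpos] at h1
      have h2 := (Finset.sum_eq_zero_iff_of_nonneg (fun l _ => sq_nonneg _)).1
        (le_antisymm h1 (Finset.sum_nonneg fun l _ => sq_nonneg _)) l (Finset.mem_univ l)
      exact pow_eq_zero_iff (two_ne_zero) |>.1 h2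
    obtain ⟨u, w, hu, hw, huw⟩ := hskew x
    have eu := eq_sum_smul_proj (η x) u (η x ⬝ᵥ η x)⁻¹ hu
    have ew := eq_sum_smul_proj (η x) w (η x ⬝ᵥ η x)⁻¹ hw
    apply huw
    change u = ∑ k, u k • a k x at eu
    change w = ∑ k, w k • a k x at ew
    have hz' : ∀ k l, toBilin' (D x) (a k x) (a l x) = toBilin' (D x) (a l x) (a k x) :=
      fun k l => sub_eq_zero.1 (hz k l)
    rw [eu, ew]
    simp only [map_sum, map_smul, LinearMap.sum_apply, LinearMap.smul_apply, smul_eq_mul, Finset.mul_sum]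
    rw [Finset.sum_comm]
    refine Finset.sum_congr rfl fun k _ => Finset.sum_congr rfl fun l _ => ?_
    rw [hz']
    ring

/-- Periodic fields `A`, `B` with time derivatives `A'`, `B'`, such that `A` moves in the kernel of
`η` and the second order term `B' ⬝ η + D(A, A')` is positive. -/
theorem exists_oscillating_fields {η : M → ι → ℝ} (hη : ContMDiff (𝓡 d) 𝓘(ℝ, ι → ℝ) ∞ η)
    {D : M → Matrix ι ι ℝ} (hD : ∀ j k, ContMDiff (𝓡 d) 𝓘(ℝ, ℝ) ∞ (fun x => D x j k))
    (hη0 : ∀ x, η x ≠ 0)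
    (hskew : ∀ x, ∃ u w, u ⬝ᵥ η x = 0 ∧ w ⬝ᵥ η x = 0 ∧ toBilin' (D x) u w ≠ toBilin' (D x) w u) :
    ∃ A A' B B' : ℝ × M → ι → ℝ,
      ContMDiff (𝓘(ℝ, ℝ).prod (𝓡 d)) 𝓘(ℝ, ι → ℝ) ∞ A ∧
      ContMDiff (𝓘(ℝ, ℝ).prod (𝓡 d)) 𝓘(ℝ, ι → ℝ) ∞ B ∧ Continuous A' ∧ Continuous B' ∧
      (∀ t x, A (t + 1, x) = A (t, x)) ∧ (∀ t x, B (t + 1, x) = B (t, x)) ∧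
      (∀ t x, HasDerivAt (fun τ => A (τ, x)) (A' (t, x)) t) ∧
      (∀ t x, HasDerivAt (fun τ => B (τ, x)) (B' (t, x)) t) ∧
      (∀ t x, A' (t, x) ⬝ᵥ η x = 0) ∧
      ∀ t x, 0 < B' (t, x) ⬝ᵥ η x + toBilin' (D x) (A (t, x)) (A' (t, x)) := by
  obtain ⟨a, b, ν, ha, hb, hν, ha0, hb0, hν1, hnn, hpos⟩ := exists_kernel_frame hη hD hη0 hskew
  -- Distinct frequencies decouple the pairs `(a k, b k)`; the shift by one excludes frequency zero.
  set N : ι → ℕ := fun k => (Fintype.equivFin ι k : ℕ) + 1 with hNdef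
  have hN : Function.Injective N := fun k l h =>
    (Fintype.equivFin ι).injective (Fin.ext (by simpa [hNdef] using h))
  have hNpos : ∀ k, 0 < N k := fun k => Nat.succ_pos _
  choose G hG hGp hGd using fun c e => hasPeriodicPrimitive_oscillation hN hNpos c e
  set W : ι ⊕ ι → M → ι → ℝ := Sum.elim a b with hW
  have hWs : ∀ c, ContMDiff (𝓡 d) 𝓘(ℝ, ι → ℝ) ∞ (W c) := by
    rintro (k | k)
    exacts [ha k, hb k]
  have hW0 : ∀ c x, W c x ⬝ᵥ η x = 0 := by
    rintro (k | k) x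
    exacts [ha0 k x, hb0 k x]
  set β : ι ⊕ ι → ι ⊕ ι → M → ℝ := fun c e x => toBilin' (D x) (W c x) (W e x) with hβ
  have hβs : ∀ c e, ContMDiff (𝓡 d) 𝓘(ℝ, ℝ) ∞ (β c e) := fun c e =>
    contMDiff_toBilin' hD (hWs c) (hWs e)
  -- `A` traces loops in the planes of `a k` and `b k`. `B` is minus the periodic primitive of the
  -- zero-mean part of `D(A, A')`, in the direction `ν` normalised by `ν ⬝ᵥ η = 1`.
  refine ⟨fun p => ∑ c, oscillation N c p.1 • W c p.2, fun p => ∑ c, oscillation' N c p.1 • W c p.2,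
    fun p => -(∑ c, ∑ e, G c e p.1 * β c e p.2) • ν p.2,
    fun p => -(∑ c, ∑ e, (oscillation N c p.1 * oscillation' N e p.1 - oscillationMean N c e) *
      β c e p.2) • ν p.2, ?_, ?_, ?_, ?_, ?_, ?_, ?_, ?_, ?_, ?_⟩
  · exact ContMDiff.sum fun c _ =>
      ((contDiff_oscillation N c).contMDiff.comp contMDiff_fst).smul ((hWs c).comp contMDiff_snd)
  · have hsum : ContMDiff (𝓘(ℝ, ℝ).prod (𝓡 d)) 𝓘(ℝ, ℝ) ∞
        (fun p : ℝ × M => ∑ c, ∑ e, G c e p.1 * β c e p.2) :=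
      ContMDiff.sum fun c _ => ContMDiff.sum fun e _ =>
        ((hG c e).contMDiff.comp contMDiff_fst).mul ((hβs c e).comp contMDiff_snd)
    exact hsum.neg.smul (hν.comp contMDiff_snd)
  · refine continuous_finsetSum _ fun c _ => Continuous.smul (?_ : Continuous fun p : ℝ × M =>
      oscillation' N c p.1) ((hWs c).continuous.comp continuous_snd)
    exact (continuous_oscillation' N c).comp continuous_fst
  · have hsum : Continuous (fun p : ℝ × M => ∑ c, ∑ e,
        (oscillation N c p.1 * oscillation' N e p.1 - oscillationMean N c e) * β c e p.2) :=
      continuous_finsetSum _ fun c _ => continuous_finsetSum _ fun e _ =>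
        ((((contDiff_oscillation N c).continuous.comp continuous_fst).mul
          ((continuous_oscillation' N e).comp continuous_fst)).sub continuous_const).mul
          ((hβs c e).continuous.comp continuous_snd)
    exact hsum.neg.smul (hν.continuous.comp continuous_snd)
  · intro t x
    simp only [oscillation_add_one]
  · intro t x
    simp only [hGp]
  · intro t x
    exact HasDerivAt.fun_sum fun c _ => (hasDerivAt_oscillation N c t).smul_const (W c x)
  · intro t x
    exact ((HasDerivAt.fun_sum fun c _ => HasDerivAt.fun_sum fun e _ =>
      (hGd c e t).mul_const (β c e x)).neg).smul_const (ν x)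
  · intro t x
    simp [sum_dotProduct, smul_dotProduct, hW0]
  · intro t x
    have h1 : toBilin' (D x) (∑ c, oscillation N c t • W c x) (∑ c, oscillation' N c t • W c x) =
        ∑ c, ∑ e, oscillation N c t * oscillation' N e t * β c e x := by
      simp only [map_sum, map_smul, LinearMap.sum_apply, LinearMap.smul_apply, smul_eq_mul, Finset.mul_sum]
      rw [Finset.sum_comm]
      refine Finset.sum_congr rfl fun k _ => Finset.sum_congr rfl fun l _ => ?_
      simp only [hβ]
      ring
    have h2 : (-(∑ c, ∑ e, (oscillation N c t * oscillation' N e t - oscillationMean N c e) *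
        β c e x) • ν x) ⬝ᵥ η x +
        toBilin' (D x) (∑ c, oscillation N c t • W c x) (∑ c, oscillation' N c t • W c x) =
        ∑ c, ∑ e, oscillationMean N c e * β c e x := by
      rw [h1, smul_dotProduct, hν1, smul_eq_mul, mul_one]
      simp only [sub_mul, Finset.sum_sub_distrib]
      ring
    simp only
    rw [h2, sum_oscillationMean N fun c e => β c e x]
    have hk : ∀ k, 0 < Real.pi * N k := fun k =>
      mul_pos Real.pi_pos (by exact_mod_cast hNpos k)
    obtain ⟨k, hkpos⟩ := hpos x
    exact Finset.sum_pos' (fun k _ => mul_nonneg (hk k).le (hnn k x))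
      ⟨k, Finset.mem_univ k, mul_pos (hk k) hkpos⟩

end OscillatingFields



/-! ### Uniform difference quotients -/

section DifferenceQuotient

variable {d : ℕ} {M : Type*} [TopologicalSpace M] [ChartedSpace (Model d) M]
  [IsManifold (𝓡 d) ∞ M] {V : Type*} [NormedAddCommGroup V] [NormedSpace ℝ V]

/-- Difference quotients in the vector variable converge locally uniformly in the other one. -/
theorem tendsto_difference_quotient {h : V × M → ℝ}
    (hh : ContMDiff (𝓘(ℝ, V).prod (𝓡 d)) 𝓘(ℝ, ℝ) ∞ h) {Y : Type*} {l : Filter Y} {r : Y → ℝ}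
    {W : Y → V} {x : Y → M} {W₀ : V} {x₀ : M} (hr : Tendsto r l (𝓝 0)) (hr0 : ∀ᶠ y in l, r y ≠ 0)
    (hW : Tendsto W l (𝓝 W₀)) (hx : Tendsto x l (𝓝 x₀)) :
    Tendsto (fun y => (h (r y • W y, x y) - h (0, x y)) / r y) l
      (𝓝 (fderiv ℝ (fun v => h (v, x₀)) 0 W₀)) := by
  set φ := chartAt (Model d) x₀ with hφdef
  have hφ : φ ∈ IsManifold.maximalAtlas (𝓡 d) ∞ M := IsManifold.chart_mem_maximalAtlas _
  have hx₀ : x₀ ∈ φ.source := mem_chart_source _ _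
  set k : V × Model d → ℝ := fun q => h (q.1, φ.symm q.2) with hk
  have hkc : ContDiffAt ℝ ∞ k (0, φ x₀) := by
    have h1 : ContMDiffAt 𝓘(ℝ, V × Model d) 𝓘(ℝ, V) ∞ (fun q : V × Model d => q.1) (0, φ x₀) :=
      contMDiffAt_iff_contDiffAt.2 contDiffAt_fst
    have h2 : ContMDiffAt 𝓘(ℝ, V × Model d) 𝓘(ℝ, Model d) ∞ (fun q : V × Model d => q.2)
        (0, φ x₀) := contMDiffAt_iff_contDiffAt.2 contDiffAt_snd
    have h3 : ContMDiffAt 𝓘(ℝ, Model d) (𝓡 d) ∞ φ.symm (φ x₀) :=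
      (contMDiffOn_symm_of_mem_maximalAtlas hφ).contMDiffAt
        (φ.open_target.mem_nhds (φ.map_source hx₀))
    have h4 : ContMDiffAt 𝓘(ℝ, V × Model d) (𝓡 d) ∞ (fun q : V × Model d => φ.symm q.2)
        (0, φ x₀) := ContMDiffAt.comp (0, φ x₀) h3 h2
    exact contMDiffAt_iff_contDiffAt.1
      (ContMDiffAt.comp (0, φ x₀) (hh (0, φ.symm (φ x₀))) (h1.prodMk h4))
  -- Strict differentiability is needed since both endpoints of the quotient move with the base
  -- point `x y`.
  have hst := hkc.hasStrictFDerivAt (by simp)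
  set D := fderiv ℝ k (0, φ x₀) with hD
  have hDW : ∀ w, fderiv ℝ (fun v => h (v, x₀)) 0 w = D (w, 0) := by
    intro w
    have h1 : HasFDerivAt (fun v => k (v, φ x₀)) (D.comp (ContinuousLinearMap.inl ℝ V (Model d))) 0 :=
      HasFDerivAt.comp (g := k) (f := fun v : V => (v, φ x₀)) (0 : V) hst.hasFDerivAt
        (hasFDerivAt_prodMk_left (0 : V) (φ x₀))
    have h2 : (fun v => k (v, φ x₀)) = fun v => h (v, x₀) := by
      funext v
      simp [hk, φ.left_inv hx₀]
    rw [h2] at h1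
    rw [h1.fderiv]
    simp
  have hφx : Tendsto (fun y => φ (x y)) l (𝓝 (φ x₀)) := (φ.continuousAt hx₀).tendsto.comp hx
  have hrW : Tendsto (fun y => r y • W y) l (𝓝 0) := by
    simpa using hr.smul hW
  have htend : Tendsto (fun y => ((r y • W y, φ (x y)), ((0 : V), φ (x y)))) l
      (𝓝 ((0, φ x₀), (0, φ x₀))) :=
    (hrW.prodMk_nhds hφx).prodMk_nhds (tendsto_const_nhds.prodMk_nhds hφx)
  have hlo := hst.isLittleO.comp_tendsto htend
  have hO : (fun y => ((r y • W y, φ (x y)) - ((0 : V), φ (x y)))) =O[l] r := by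
    have h1 : W =O[l] (fun _ => (1 : ℝ)) := hW.isBigO_one ℝ
    have h2 : (fun y => r y • W y) =O[l] fun y => r y • (1 : ℝ) :=
      (Asymptotics.isBigO_refl r l).smul h1
    simp only [smul_eq_mul, mul_one] at h2
    refine (Asymptotics.IsBigO.of_bound 1 (Eventually.of_forall fun y => ?_)).trans h2
    simp
  have hlim := (hlo.trans_isBigO hO).tendsto_div_nhds_zero
  have hDlim : Tendsto (fun y => D (W y, 0)) l (𝓝 (D (W₀, 0))) :=
    (D.continuous.tendsto _).comp (hW.prodMk_nhds tendsto_const_nhds)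
  rw [hDW]
  have hsum := hlim.add hDlim
  rw [zero_add] at hsum
  refine hsum.congr' ?_
  filter_upwards [hr0, hx.eventually (φ.open_source.mem_nhds hx₀)] with y hy hys
  have e1 : ((r y • W y, φ (x y)) - ((0 : V), φ (x y))) = r y • (W y, (0 : Model d)) := by
    ext <;> simp
  simp only [Function.comp_apply, e1, map_smul, smul_eq_mul, hk, φ.left_inv hys]
  field_simp
  ring

/-- The derivative of a smooth function in the vector variable is smooth in the other one. -/
theorem contMDiff_fderiv_param {h : V × M → ℝ}
    (hh : ContMDiff (𝓘(ℝ, V).prod (𝓡 d)) 𝓘(ℝ, ℝ) ∞ h) (u : V) :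
    ContMDiff (𝓡 d) 𝓘(ℝ, ℝ) ∞ (fun x => fderiv ℝ (fun v => h (v, x)) 0 u) := by
  intro x₀
  have h1 : ContMDiffAt ((𝓡 d).prod 𝓘(ℝ, V)) 𝓘(ℝ, ℝ) ∞
      (Function.uncurry fun (x : M) (v : V) => h (v, x)) (x₀, 0) :=
    (hh.comp (contMDiff_snd.prodMk contMDiff_fst)) (x₀, 0)
  have h2 := ContMDiffAt.mfderiv (m := ∞) (fun (x : M) (v : V) => h (v, x)) (fun _ => (0 : V)) h1
    contMDiffAt_const (by simp)
  have e := inTangentCoordinates_model_space (I := 𝓘(ℝ, V)) (I' := 𝓘(ℝ, ℝ)) (fun _ : M => (0 : V))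
    (fun x => h (0, x)) (fun x => mfderiv 𝓘(ℝ, V) 𝓘(ℝ, ℝ) (fun v => h (v, x)) 0) x₀
  have h3 : ContMDiffAt (𝓡 d) 𝓘(ℝ, V →L[ℝ] ℝ) ∞ (fun x => fderiv ℝ (fun v => h (v, x)) 0) x₀ := by
    refine h2.congr_of_eventuallyEq (Eventually.of_forall fun x => ?_)
    exact mfderiv_eq_fderiv.symm.trans (congrFun e x).symm
  exact h3.clm_apply contMDiffAt_const

end DifferenceQuotient

/-! ### Components of the pulled-back contact form -/

section PullbackComponents

variable {d : ℕ} {M : Type*} [TopologicalSpace M] [ChartedSpace (Model d) M]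
  {ι : Type*} [Fintype ι]

theorem contMDiff_slice {E : (ι → ℝ) × M → M}
    (hE : ContMDiff (𝓘(ℝ, ι → ℝ).prod (𝓡 d)) (𝓡 d) ∞ E)
    (x : M) : ContMDiff 𝓘(ℝ, ι → ℝ) (𝓡 d) ∞ (fun v => E (v, x)) :=
  hE.comp (contMDiff_id.prodMk contMDiff_const)

variable [IsManifold (𝓡 d) ∞ M]

/-- The value on the constant vector `w` of the pull-back of `α` by `v ↦ E (v, x)`. -/
def pullbackComp (α : OneForm d M) (E : (ι → ℝ) × M → M) (w : ι → ℝ) (p : (ι → ℝ) × M) : ℝ :=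
  α.eval (E p) (mfderiv 𝓘(ℝ, ι → ℝ) (𝓡 d) (fun v => E (v, p.2)) p.1 w)

variable {α : OneForm d M} {E : (ι → ℝ) × M → M}

theorem contMDiff_pullbackComp
    (hE : ContMDiff (𝓘(ℝ, ι → ℝ).prod (𝓡 d)) (𝓡 d) ∞ E)
    (w : ι → ℝ) :
    ContMDiff (𝓘(ℝ, ι → ℝ).prod (𝓡 d)) 𝓘(ℝ, ℝ) ∞ (pullbackComp α E w) := by
  intro p₀
  have h1 : ContMDiffAt ((𝓘(ℝ, ι → ℝ).prod (𝓡 d)).prod 𝓘(ℝ, ℝ)) (𝓡 d) ∞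
      (Function.uncurry fun (p : (ι → ℝ) × M) (σ : ℝ) => E (p.1 + σ • w, p.2)) (p₀, 0) := by
    have e : ContMDiff ((𝓘(ℝ, ι → ℝ).prod (𝓡 d)).prod 𝓘(ℝ, ℝ)) 𝓘(ℝ, ι → ℝ) ∞
        (fun z : ((ι → ℝ) × M) × ℝ => z.1.1 + z.2 • w) :=
      contMDiff_fst.fst.add (contMDiff_snd.smul contMDiff_const)
    exact (hE.comp (e.prodMk contMDiff_fst.snd)) (p₀, 0)
  have h2 := contMDiffAt_eval_velocity_zero α h1
  refine h2.congr_of_eventuallyEq (Eventually.of_forall fun p => ?_)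
  have h3 := mfderiv_comp_line (((contMDiff_slice hE p.2) p.1).mdifferentiableAt (by simp)) w
  have h4 : E (p.1 + (0 : ℝ) • w, p.2) = E p := by simp
  simp only [pullbackComp]
  rw [h3, h4]

theorem pullbackComp_eq_sum [DecidableEq ι] (w : ι → ℝ) (p : (ι → ℝ) × M) :
    pullbackComp α E w p = ∑ k, w k * pullbackComp α E (Pi.single k 1) p := by
  let L : (ι → ℝ) →L[ℝ] ℝ := (α (E p) : Model d →L[ℝ] ℝ).comp
    (mfderiv 𝓘(ℝ, ι → ℝ) (𝓡 d) (fun v => E (v, p.2)) p.1 : (ι → ℝ) →L[ℝ] Model d)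
  have h : ∀ u, pullbackComp α E u p = L u := fun u => rfl
  simp only [h]
  conv_lhs => rw [pi_eq_sum_univ' w]
  simp [map_sum]

/-- Expresses the derivative for arbitrary constant `w` through the components, so that it can be
read as the bilinear form of the matrix `D`. -/
theorem fderiv_pullbackComp_eq_sum [DecidableEq ι]
    (hE : ContMDiff (𝓘(ℝ, ι → ℝ).prod (𝓡 d)) (𝓡 d) ∞ E)
    (u w : ι → ℝ) (x : M) :
    fderiv ℝ (fun v => pullbackComp α E w (v, x)) 0 u =
      ∑ k, w k * fderiv ℝ (fun v => pullbackComp α E (Pi.single k 1) (v, x)) 0 u := by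
  have hd : ∀ k, DifferentiableAt ℝ (fun v => pullbackComp α E (Pi.single k 1) (v, x)) 0 := by
    intro k
    have h : ContMDiff 𝓘(ℝ, ι → ℝ) 𝓘(ℝ, ℝ) ∞
        (fun v => pullbackComp α E (Pi.single k 1) (v, x)) :=
      (contMDiff_pullbackComp hE _).comp (contMDiff_id.prodMk contMDiff_const)
    exact (contMDiff_iff_contDiff.1 h).contDiffAt.differentiableAt (by simp)
  have e : (fun v => pullbackComp α E w (v, x)) =
      fun v => ∑ k, w k * pullbackComp α E (Pi.single k 1) (v, x) :=
    funext fun v => pullbackComp_eq_sum w (v, x)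
  rw [e, fderiv_fun_sum fun k _ => (hd k).const_mul (w k)]
  simp only [sum_apply]
  refine Finset.sum_congr rfl fun k _ => ?_
  rw [fderiv_const_mul (hd k)]
  simp

/-- The velocity of `t ↦ E (V t, x)` evaluated by `α`. -/
theorem eval_mfderiv_comp [DecidableEq ι]
    (hE : ContMDiff (𝓘(ℝ, ι → ℝ).prod (𝓡 d)) (𝓡 d) ∞ E)
    {V : ℝ → ι → ℝ} {V' : ι → ℝ} {t : ℝ}
    (hV : HasDerivAt V V' t) (x : M) :
    α.eval (E (V t, x)) (mfderiv 𝓘(ℝ, ℝ) (𝓡 d) (fun τ => E (V τ, x)) t (1 : ℝ)) =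
      ∑ k, V' k * pullbackComp α E (Pi.single k 1) (V t, x) := by
  rw [← pullbackComp_eq_sum]
  have h1 : MDifferentiableAt 𝓘(ℝ, ι → ℝ) (𝓡 d) (fun v => E (v, x)) (V t) :=
    ((contMDiff_slice hE x) (V t)).mdifferentiableAt (by simp)
  have h2 := (HasMFDerivAt.comp t h1.hasMFDerivAt hV.hasFDerivAt.hasMFDerivAt).mfderiv
  have h3 : (mfderiv 𝓘(ℝ, ℝ) (𝓡 d) (fun τ => E (V τ, x)) t (1 : ℝ) : Model d) =
      (mfderiv 𝓘(ℝ, ι → ℝ) (𝓡 d) (fun v => E (v, x)) (V t) : (ι → ℝ) →L[ℝ] Model d) V' :=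
    (congrArg (fun L : ℝ →L[ℝ] Model d => L 1) h2).trans
      (congrArg (mfderiv 𝓘(ℝ, ι → ℝ) (𝓡 d) (fun v => E (v, x)) (V t) : (ι → ℝ) →L[ℝ] Model d)
        (one_smul ℝ V'))
  exact congrArg (fun v : Model d => α.eval (E (V t, x)) v) h3

end PullbackComponents



/-! ### Second-order expansion of the velocity -/

section PositiveFamily

open Matrix

variable {d : ℕ} {M : Type*} [TopologicalSpace M] [ChartedSpace (Model d) M]
  [IsManifold (𝓡 d) ∞ M] {ι : Type*} [Fintype ι]

/-- Along `V = r A + r² B` the pull-back form is positive on `∂_t V` for small `r ≠ 0`. -/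
theorem eventually_pos_of_second_order {h : ι → (ι → ℝ) × M → ℝ}
    (hh : ∀ k, ContMDiff (𝓘(ℝ, ι → ℝ).prod (𝓡 d)) 𝓘(ℝ, ℝ) ∞ (h k)) {A A' B B' : ℝ × M → ι → ℝ}
    (hA : Continuous A) (hA' : Continuous A') (hB : Continuous B) (hB' : Continuous B')
    (hker : ∀ t x, A' (t, x) ⬝ᵥ (fun k => h k (0, x)) = 0) {t₀ : ℝ} {x₀ : M}
    (hpos : 0 < B' (t₀, x₀) ⬝ᵥ (fun k => h k (0, x₀)) +
      ∑ k, A' (t₀, x₀) k * fderiv ℝ (fun v => h k (v, x₀)) 0 (A (t₀, x₀))) :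
    ∀ᶠ q : (ℝ × ℝ) × M in 𝓝 ((0, t₀), x₀), q.1.1 ≠ 0 →
      0 < ∑ k, (q.1.1 • A' (q.1.2, q.2) + q.1.1 ^ 2 • B' (q.1.2, q.2)) k *
        h k (q.1.1 • A (q.1.2, q.2) + q.1.1 ^ 2 • B (q.1.2, q.2), q.2) := by
  set S : Set ((ℝ × ℝ) × M) := {q | q.1.1 ≠ 0} with hS
  set l := 𝓝[S] (((0 : ℝ), t₀), x₀) with hl
  have hle : l ≤ 𝓝 (((0 : ℝ), t₀), x₀) := nhdsWithin_le_nhds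
  have hr : Tendsto (fun q : (ℝ × ℝ) × M => q.1.1) l (𝓝 0) :=
    (continuous_fst.fst.tendsto (((0 : ℝ), t₀), x₀)).mono_left hle
  have hx : Tendsto (fun q : (ℝ × ℝ) × M => q.2) l (𝓝 x₀) :=
    (continuous_snd.tendsto (((0 : ℝ), t₀), x₀)).mono_left hle
  have hr0 : ∀ᶠ q in l, q.1.1 ≠ 0 := self_mem_nhdsWithin
  have hcomp : ∀ {C : ℝ × M → ι → ℝ}, Continuous C →
      Tendsto (fun q : (ℝ × ℝ) × M => C (q.1.2, q.2)) l (𝓝 (C (t₀, x₀))) := fun hC =>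
    ((hC.comp (continuous_fst.snd.prodMk continuous_snd)).tendsto
      (((0 : ℝ), t₀), x₀)).mono_left hle
  have hW : Tendsto (fun q : (ℝ × ℝ) × M => A (q.1.2, q.2) + q.1.1 • B (q.1.2, q.2)) l
      (𝓝 (A (t₀, x₀))) := by
    simpa using (hcomp hA).add (hr.smul (hcomp hB))
  have hW' : Tendsto (fun q : (ℝ × ℝ) × M => A' (q.1.2, q.2) + q.1.1 • B' (q.1.2, q.2)) l
      (𝓝 (A' (t₀, x₀))) := by
    simpa using (hcomp hA').add (hr.smul (hcomp hB'))
  have hquot := fun k => tendsto_difference_quotient (hh k) hr hr0 hW hx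
  have hh0 : ∀ k, Tendsto (fun q : (ℝ × ℝ) × M => h k (0, q.2)) l (𝓝 (h k (0, x₀))) := fun k =>
    ((((hh k).continuous.comp (continuous_const.prodMk continuous_snd)).tendsto
      (((0 : ℝ), t₀), x₀)).mono_left hle)
  -- This is the velocity term divided by `r²`, after removal of the first-order term killed by
  -- `hker`. Its limit is the positive number of `hpos`, so it is positive on a punctured
  -- neighbourhood in `r`.
  have hlim : Tendsto (fun q : (ℝ × ℝ) × M =>
      ∑ k, B' (q.1.2, q.2) k * h k (0, q.2) +
      ∑ k, (A' (q.1.2, q.2) + q.1.1 • B' (q.1.2, q.2)) k *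
        ((h k (q.1.1 • (A (q.1.2, q.2) + q.1.1 • B (q.1.2, q.2)), q.2) - h k (0, q.2)) / q.1.1)) l
      (𝓝 (B' (t₀, x₀) ⬝ᵥ (fun k => h k (0, x₀)) +
        ∑ k, A' (t₀, x₀) k * fderiv ℝ (fun v => h k (v, x₀)) 0 (A (t₀, x₀)))) :=
    (tendsto_finsetSum _ fun k _ => ((tendsto_pi_nhds.1 (hcomp hB')) k).mul (hh0 k)).add
      (tendsto_finsetSum _ fun k _ => ((tendsto_pi_nhds.1 hW') k).mul (hquot k))
  have hev := hlim.eventually_const_lt hpos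
  rw [hl, eventually_nhdsWithin_iff] at hev
  filter_upwards [hev] with q hq hq0
  have hq1 := hq hq0
  have hk0 : ∑ k, A' (q.1.2, q.2) k * h k (0, q.2) = 0 := hker q.1.2 q.2
  have hr2 : 0 < q.1.1 ^ 2 := by positivity
  have hVeq : q.1.1 • A (q.1.2, q.2) + q.1.1 ^ 2 • B (q.1.2, q.2) =
      q.1.1 • (A (q.1.2, q.2) + q.1.1 • B (q.1.2, q.2)) := by
    rw [smul_add, smul_smul, sq]
  have key : ∑ k, (q.1.1 • A' (q.1.2, q.2) + q.1.1 ^ 2 • B' (q.1.2, q.2)) k *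
        h k (q.1.1 • A (q.1.2, q.2) + q.1.1 ^ 2 • B (q.1.2, q.2), q.2) =
      q.1.1 * (∑ k, A' (q.1.2, q.2) k * h k (0, q.2)) + q.1.1 ^ 2 * (
      ∑ k, B' (q.1.2, q.2) k * h k (0, q.2) +
      ∑ k, (A' (q.1.2, q.2) + q.1.1 • B' (q.1.2, q.2)) k *
        ((h k (q.1.1 • (A (q.1.2, q.2) + q.1.1 • B (q.1.2, q.2)), q.2) - h k (0, q.2)) /
          q.1.1)) := by
    rw [hVeq, ← Finset.sum_add_distrib, Finset.mul_sum, Finset.mul_sum, ← Finset.sum_add_distrib]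
    refine Finset.sum_congr rfl fun k _ => ?_
    simp only [Pi.add_apply, Pi.smul_apply, smul_eq_mul]
    field_simp
    ring
  rw [key, hk0, mul_zero, zero_add]
  exact mul_pos hr2 hq1

end PositiveFamily

/-! ### The positive family on a contact manifold -/

section ContactFamily

open Matrix

variable {n : ℕ} {M : Type*} [TopologicalSpace M] [ChartedSpace (Model (2 * n + 1)) M]
  [IsManifold (𝓡 (2 * n + 1)) ∞ M]

/-- On a closed contact manifold there is a smooth two-parameter family of self-maps, periodic in
the second parameter, which is the identity when the first parameter vanishes, and whose velocity
is positively transverse to the contact structure when the first one is small and nonzero. -/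
theorem exists_positive_family [CompactSpace M] [T2Space M] (hn : 1 ≤ n)
    {α : OneForm (2 * n + 1) M} (hα : α.IsContact) :
    ∃ F : (ℝ × ℝ) × M → M,
      ContMDiff (𝓘(ℝ, ℝ × ℝ).prod (𝓡 (2 * n + 1))) (𝓡 (2 * n + 1)) ∞ F ∧
      (∀ t x, F ((0, t), x) = x) ∧ (∀ r t x, F ((r, t + 1), x) = F ((r, t), x)) ∧
      ∀ t₀ x₀, ∀ᶠ q : (ℝ × ℝ) × M in 𝓝 ((0, t₀), x₀), q.1.1 ≠ 0 →
        0 < α.eval (F q) (mfderiv 𝓘(ℝ, ℝ) (𝓡 (2 * n + 1)) (fun τ => F ((q.1.1, τ), q.2)) q.1.2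
          (1 : ℝ)) := by
  classical
  obtain ⟨ι, hι, E, hE, hE0, hspan⟩ := exists_spray (d := 2 * n + 1) (M := M)
  set h : ι → (ι → ℝ) × M → ℝ := fun k => pullbackComp α E (Pi.single k 1) with hh
  have hhs : ∀ k, ContMDiff (𝓘(ℝ, ι → ℝ).prod (𝓡 (2 * n + 1))) 𝓘(ℝ, ℝ) ∞ (h k) := fun k =>
    contMDiff_pullbackComp hE _
  set η : M → ι → ℝ := fun x k => h k (0, x) with hη
  have hηs : ContMDiff (𝓡 (2 * n + 1)) 𝓘(ℝ, ι → ℝ) ∞ η :=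
    contMDiff_pi_space.2 fun k => (hhs k).comp (contMDiff_const.prodMk contMDiff_id)
  set D : M → Matrix ι ι ℝ := fun x j k => fderiv ℝ (fun v => h k (v, x)) 0 (Pi.single j 1) with hD
  have hDs : ∀ j k, ContMDiff (𝓡 (2 * n + 1)) 𝓘(ℝ, ℝ) ∞ (fun x => D x j k) := fun j k =>
    contMDiff_fderiv_param (hhs k) _
  have hbil : ∀ x u w, toBilin' (D x) u w = ∑ k, w k * fderiv ℝ (fun v => h k (v, x)) 0 u := by
    intro x u w
    rw [toBilin'_apply, Finset.sum_comm]
    refine Finset.sum_congr rfl fun k _ => ?_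
    conv_rhs => rw [pi_eq_sum_univ' u]
    simp only [map_sum, map_smul, smul_eq_mul, Finset.mul_sum, hD]
    refine Finset.sum_congr rfl fun j _ => ?_
    ring
  have hdot : ∀ x w, w ⬝ᵥ η x = pullbackComp α E w (0, x) := fun x w =>
    (pullbackComp_eq_sum w (0, x)).symm
  -- The spanning property of the spray, read as surjectivity of the differential of `v ↦ E (v, x)`
  -- at `0`.
  have hlift : ∀ (x : M) (v : Model (2 * n + 1)), ∃ w : ι → ℝ,
      (mfderiv 𝓘(ℝ, ι → ℝ) (𝓡 (2 * n + 1)) (fun v => E (v, x)) 0 w : Model (2 * n + 1)) = v := by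
    intro x v
    obtain ⟨w, hw⟩ := hspan x v
    refine ⟨w, ?_⟩
    rw [← hw]
    have h1 := mfderiv_comp_line (((contMDiff_slice hE x) 0).mdifferentiableAt (by simp)) w
    have h2 : (fun σ : ℝ => E (σ • w, x)) = fun σ : ℝ => E (0 + σ • w, x) := by simp
    exact (((congrArg velocityZero h2).trans h1)).symm
  have heval : ∀ (x : M) (v : Model (2 * n + 1)), α.eval (E (0, x)) v = α.eval x v := by
    intro x v
    rw [hE0]
  have hη0 : ∀ x, η x ≠ 0 := by
    intro x hx
    obtain ⟨v, hv⟩ := hα.exists_eval_ne_zero x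
    obtain ⟨w, hw⟩ := hlift x v
    apply hv
    have h1 := hdot x w
    rw [hx, dotProduct_zero] at h1
    rw [← heval x v, ← hw]
    exact h1.symm
  have hskew : ∀ x, ∃ u w, u ⬝ᵥ η x = 0 ∧ w ⬝ᵥ η x = 0 ∧
      toBilin' (D x) u w ≠ toBilin' (D x) w u := by
    intro x
    obtain ⟨u, w, hu, hw, huw⟩ := hα.exists_extDeriv_ne_zero hn x
    obtain ⟨u', hu'⟩ := hlift x u
    obtain ⟨w', hw'⟩ := hlift x w
    refine ⟨u', w', ?_, ?_, ?_⟩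
    · rw [hdot]
      refine Eq.trans ?_ hu
      rw [← heval x u, ← hu']
      rfl
    · rw [hdot]
      refine Eq.trans ?_ hw
      rw [← heval x w, ← hw']
      rfl
    -- The skew part of `D x` is the pull-back of `dα` by `v ↦ E (v, x)`, so lifts of vectors of `ξ`
    -- with `dα ≠ 0` suffice.
    · rw [hbil, hbil, ← fderiv_pullbackComp_eq_sum hE, ← fderiv_pullbackComp_eq_sum hE]
      intro heq
      apply huw
      have h1 := α.extDeriv_pullback ((contMDiff_slice hE x) 0) u' w'
      have h2 : fderiv ℝ (fun y => α.eval (E (y, x))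
          (mfderiv 𝓘(ℝ, ι → ℝ) (𝓡 (2 * n + 1)) (fun v => E (v, x)) y w')) 0 u' -
          fderiv ℝ (fun y => α.eval (E (y, x))
          (mfderiv 𝓘(ℝ, ι → ℝ) (𝓡 (2 * n + 1)) (fun v => E (v, x)) y u')) 0 w' = 0 :=
        sub_eq_zero.2 heq
      have h3 : ∀ a b : Model (2 * n + 1), α.extDeriv (E (0, x)) a b = α.extDeriv x a b := by
        intro a b
        rw [hE0]
      refine (h3 u w).symm.trans ?_
      rw [← hu', ← hw']
      exact h1.symm.trans h2
  obtain ⟨A, A', B, B', hA, hB, hA', hB', hAp, hBp, hAd, hBd, hker, hpos⟩ :=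
    exists_oscillating_fields hηs hDs hη0 hskew
  set V : (ℝ × ℝ) × M → ι → ℝ := fun q => q.1.1 • A (q.1.2, q.2) + q.1.1 ^ 2 • B (q.1.2, q.2) with hV
  have hVs : ContMDiff (𝓘(ℝ, ℝ × ℝ).prod (𝓡 (2 * n + 1))) 𝓘(ℝ, ι → ℝ) ∞ V := by
    have hr : ContMDiff (𝓘(ℝ, ℝ × ℝ).prod (𝓡 (2 * n + 1))) 𝓘(ℝ, ℝ) ∞
        (fun q : (ℝ × ℝ) × M => q.1.1) := contDiff_fst.contMDiff.comp contMDiff_fst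
    have ht : ContMDiff (𝓘(ℝ, ℝ × ℝ).prod (𝓡 (2 * n + 1))) 𝓘(ℝ, ℝ) ∞
        (fun q : (ℝ × ℝ) × M => q.1.2) := contDiff_snd.contMDiff.comp contMDiff_fst
    exact (hr.smul (hA.comp (ht.prodMk contMDiff_snd))).add
      ((hr.pow 2).smul (hB.comp (ht.prodMk contMDiff_snd)))
  refine ⟨fun q => E (V q, q.2), hE.comp (hVs.prodMk contMDiff_snd), ?_, ?_, ?_⟩
  · intro t x
    simp [hV, hE0]
  · intro r t x
    simp only [hV, hAp, hBp]
  · intro t₀ x₀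
    have hp := hpos t₀ x₀
    rw [hbil] at hp
    filter_upwards [eventually_pos_of_second_order hhs hA.continuous hA' hB.continuous hB' hker hp]
      with q hq hq0
    have hder : HasDerivAt (fun τ => V ((q.1.1, τ), q.2))
        (q.1.1 • A' (q.1.2, q.2) + q.1.1 ^ 2 • B' (q.1.2, q.2)) q.1.2 :=
      ((hAd q.1.2 q.2).const_smul q.1.1).add ((hBd q.1.2 q.2).const_smul (q.1.1 ^ 2))
    exact (hq hq0).trans_eq (eval_mfderiv_comp hE hder q.2).symm

end ContactFamily



/-! ### Passing to diffeomorphisms and periodic curves -/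

section Homotopy

variable {d : ℕ} {M : Type*} [TopologicalSpace M] [ChartedSpace (Model d) M]

open Classical in
/-- The diffeomorphism with underlying map `f`, if there is one, and the identity otherwise. -/
def toDiff (f : M → M) : Diff d M :=
  if h : ∃ g : Diff d M, ⇑g = f then h.choose else Diffeomorph.refl (𝓡 d) M ∞

theorem toDiff_apply {f : M → M} (h : ∃ g : Diff d M, ⇑g = f) (x : M) :
    toDiff (d := d) f x = f x := by
  rw [toDiff, dif_pos h]
  exact congrFun h.choose_spec x

/-- The velocity lives in the tangent space at `γ t`, so equal curves are exchanged by substitution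
rather than by rewriting inside the dependent type. -/
theorem OneForm.pos_velocity_congr [IsManifold (𝓡 d) ∞ M] (α : OneForm d M) {γ γ' : ℝ → M}
    (h : γ = γ') {t : ℝ}
    (hpos : 0 < α.eval (γ' t) (mfderiv 𝓘(ℝ, ℝ) (𝓡 d) γ' t (1 : ℝ))) :
    0 < α.eval (γ t) (mfderiv 𝓘(ℝ, ℝ) (𝓡 d) γ t (1 : ℝ)) := by
  subst h
  exact hpos

/-- The velocity of a periodic curve is periodic. -/
theorem OneForm.pos_velocity_of_periodic [IsManifold (𝓡 d) ∞ M] (α : OneForm d M) {γ : ℝ → M}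
    (hγ : ContMDiff 𝓘(ℝ, ℝ) (𝓡 d) ∞ γ) (hp : Function.Periodic γ 1) {t : ℝ}
    (hpos : 0 < α.eval (γ (Int.fract t)) (mfderiv 𝓘(ℝ, ℝ) (𝓡 d) γ (Int.fract t) (1 : ℝ))) :
    0 < α.eval (γ t) (mfderiv 𝓘(ℝ, ℝ) (𝓡 d) γ t (1 : ℝ)) := by
  have h1 : (fun τ => γ (τ - ⌊t⌋)) = γ := by
    funext τ
    simpa using hp.sub_int_mul_eq (x := τ) ⌊t⌋
  refine α.pos_velocity_congr h1.symm ?_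
  have hs : HasFDerivAt (fun τ : ℝ => τ - ⌊t⌋) (ContinuousLinearMap.id ℝ ℝ) t :=
    (hasFDerivAt_id t).sub_const _
  have hm := (HasMFDerivAt.comp t ((hγ (t - ⌊t⌋)).mdifferentiableAt (by simp)).hasMFDerivAt
    hs.hasMFDerivAt).mfderiv
  have h2 : (mfderiv 𝓘(ℝ, ℝ) (𝓡 d) (fun τ => γ (τ - ⌊t⌋)) t (1 : ℝ) : Model d) =
      (mfderiv 𝓘(ℝ, ℝ) (𝓡 d) γ (t - ⌊t⌋) : ℝ →L[ℝ] Model d) 1 :=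
    congrArg (fun L : ℝ →L[ℝ] Model d => L 1) hm
  exact hpos.trans_eq (congrArg (fun v : Model d => α.eval (γ (t - ⌊t⌋)) v) h2).symm

end Homotopy

end ContactPositivity

end

/-! ### The homotopy of positive loops -/

theorem mainTheorem6 (n : ℕ) (hn : 1 ≤ n) (M : Type*) [TopologicalSpace M] [T2Space M]
    [CompactSpace M] [ChartedSpace (ContactPositivity.Model (2 * n + 1)) M]
    [IsManifold (𝓡 (2 * n + 1)) ∞ M]
    (ξ : ContactPositivity.CoorientedContactStructure n M) :
    ∃ H : UnitAddCircle × unitInterval → ContactPositivity.Diff (2 * n + 1) M,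
      Continuous H ∧
      (∀ p, H p ∈ ContactPositivity.Diff₀ (2 * n + 1) M) ∧
      (∀ t : UnitAddCircle, H (t, 1) = Diffeomorph.refl (𝓡 (2 * n + 1)) M ∞) ∧
      ∀ s : unitInterval, s < 1 →
        ContactPositivity.IsPositiveLoop ξ (fun t : UnitAddCircle => H (t, s)) := by
  open ContactPositivity Set Filter Topology in
  obtain ⟨α, hα, hplane, hside⟩ := ξ.exists_contactForm
  obtain ⟨F, hF, hF0, hFp, hFpos⟩ := exists_positive_family hn hα
  -- Compactness of `[0, 1]` and of `M` turns the local statements into one bound on `r`;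
  -- periodicity later extends it to all `t`.
  have hsmall : ∀ᶠ r : ℝ in 𝓝 0, ∀ t ∈ Icc (0 : ℝ) 1,
      (∃ g : Diff (2 * n + 1) M, ∀ x, g x = F ((r, t), x)) ∧ ∀ x ∈ (univ : Set M), r ≠ 0 →
        0 < α.eval (F ((r, t), x))
          (mfderiv 𝓘(ℝ, ℝ) (𝓡 (2 * n + 1)) (fun τ => F ((r, τ), x)) t (1 : ℝ)) := by
    refine isCompact_Icc.eventually_forall_of_forall_eventually (x₀ := (0 : ℝ)) fun t₀ _ => ?_
    have h2 := isCompact_univ.eventually_forall_of_forall_eventually (x₀ := ((0 : ℝ), t₀))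
      (P := fun (p : ℝ × ℝ) (x : M) => p.1 ≠ 0 → 0 < α.eval (F (p, x))
        (mfderiv 𝓘(ℝ, ℝ) (𝓡 (2 * n + 1)) (fun τ => F ((p.1, τ), x)) p.2 (1 : ℝ)))
      fun x₀ _ => hFpos t₀ x₀
    exact (eventually_exists_diff hF (p₀ := ((0 : ℝ), t₀)) (hF0 t₀)).and h2
  obtain ⟨ε, hε, hεF⟩ := Metric.eventually_nhds_iff.1 hsmall
  -- Half of `ε`, so that the closed interval `[0, r₀]` lies in the open ball where everything
  -- holds.
  set r₀ := ε / 2 with hr₀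
  have hr₀pos : 0 < r₀ := half_pos hε
  have hper : ∀ r x, Function.Periodic (fun t => F ((r, t), x)) 1 := fun r x t => hFp r t x
  have hfract : ∀ r t x, F ((r, Int.fract t), x) = F ((r, t), x) := by
    intro r t x
    simpa using (hper r x).sub_int_mul_eq (x := t) ⌊t⌋
  have hgood : ∀ r : ℝ, 0 ≤ r → r ≤ r₀ → ∀ t ∈ Icc (0 : ℝ) 1, _ := fun r h0 h1 =>
    hεF (y := r) (by rw [Real.dist_eq, sub_zero, abs_of_nonneg h0]; linarith)
  have hdiff : ∀ r : ℝ, 0 ≤ r → r ≤ r₀ → ∀ t : ℝ,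
      ∃ g : Diff (2 * n + 1) M, ⇑g = fun x => F ((r, t), x) := by
    intro r h0 h1 t
    obtain ⟨g, hg⟩ := (hgood r h0 h1 (Int.fract t)
      ⟨Int.fract_nonneg t, (Int.fract_lt_one t).le⟩).1
    exact ⟨g, funext fun x => (hg x).trans (hfract r t x)⟩
  set Φ : ℝ × ℝ → Diff (2 * n + 1) M := fun p => toDiff (fun x => F (p, x)) with hΦ
  have hΦF : ∀ p ∈ {p : ℝ × ℝ | 0 ≤ p.1 ∧ p.1 ≤ r₀}, ∀ x, Φ p x = F (p, x) := fun p hp x =>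
    toDiff_apply (hdiff p.1 hp.1 hp.2 p.2) x
  have hΦp : ∀ r, Function.Periodic (fun t => Φ (r, t)) 1 := by
    intro r t
    simp only [hΦ, hFp]
  -- The amplitude is positive for `s < 1` and zero at `s = 1`, where the family is the identity.
  set ρ : unitInterval → ℝ := fun s => r₀ * (1 - s) with hρ
  have hρ01 : ∀ s, 0 ≤ ρ s ∧ ρ s ≤ r₀ := fun s =>
    ⟨mul_nonneg hr₀pos.le (by linarith [s.2.2]), by
      have := mul_nonneg hr₀pos.le s.2.1
      simp only [hρ]
      linarith⟩
  let H : UnitAddCircle × unitInterval → Diff (2 * n + 1) M := fun p => (hΦp (ρ p.2)).lift p.1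
  have hHcoe : ∀ (t : ℝ) s, H (t, s) = Φ (ρ s, t) := fun t s => rfl
  have hHF : ∀ (t : ℝ) s x, H (t, s) x = F ((ρ s, t), x) := fun t s x => hΦF (ρ s, t) (hρ01 s) x
  have hHc : Continuous H := by
    -- The product of the circle projection with the identity is still a quotient map, so continuity
    -- may be checked over `ℝ × [0, 1]`.
    have hq : IsOpenQuotientMap (Prod.map ((↑) : ℝ → UnitAddCircle) (id : unitInterval → unitInterval)) :=
      QuotientAddGroup.isOpenQuotientMap_mk.prodMap .id
    rw [hq.isQuotientMap.continuous_iff]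
    exact (continuousOn_diff_of_contMDiff hF hΦF).comp_continuous
      (f := fun p : ℝ × unitInterval => (ρ p.2, p.1))
      (by simp only [hρ]; fun_prop) fun p => hρ01 p.2
  have hH1 : ∀ t : UnitAddCircle, H (t, 1) = Diffeomorph.refl (𝓡 (2 * n + 1)) M ∞ := by
    intro t
    obtain ⟨t, rfl⟩ := QuotientAddGroup.mk_surjective t
    ext x
    refine (hHF t 1 x).trans ?_
    have : ρ 1 = 0 := by simp [hρ]
    rw [this, hF0]
    rfl
  refine ⟨H, hHc, fun p => ?_, hH1, fun s hs => ⟨?_, ?_⟩⟩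
  -- The image of `H` is connected and contains the identity.
  · exact (isPreconnected_range hHc).subset_connectedComponent (mem_range.2 ⟨(0, 1), hH1 0⟩)
      (mem_range_self p)
  · have hs1 : ContMDiff (𝓘(ℝ, ℝ).prod (𝓡 (2 * n + 1))) 𝓘(ℝ, ℝ × ℝ) ∞
        (fun p : ℝ × M => (ρ s, p.1)) :=
      (contDiff_const.prodMk contDiff_id : ContDiff ℝ ∞ fun t : ℝ => (ρ s, t)).contMDiff.comp
        contMDiff_fst
    have hs2 := hF.comp (hs1.prodMk contMDiff_snd)
    exact hs2.congr fun p => hHF p.1 s p.2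
  · intro α' hα' t x
    -- Positivity depends only on the positive side of `ξ`, so any defining form may be replaced by
    -- `α`.
    refine (hα'.2.2 _ _).1 ((hside _ _).2 ?_)
    have hρs : 0 < ρ s := mul_pos hr₀pos (sub_pos.2 hs)
    refine α.pos_velocity_congr (γ := fun τ : ℝ => H (τ, s) x) (funext fun τ => hHF τ s x) ?_
    have hcurve : ContMDiff 𝓘(ℝ, ℝ) (𝓡 (2 * n + 1)) ∞ (fun τ => F ((ρ s, τ), x)) :=
      hF.comp ((contDiff_const.prodMk contDiff_id :
        ContDiff ℝ ∞ fun t : ℝ => (ρ s, t)).contMDiff.prodMk contMDiff_const)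
    exact α.pos_velocity_of_periodic hcurve (hper (ρ s) x)
      ((hgood (ρ s) (hρ01 s).1 (hρ01 s).2 (Int.fract t)
        ⟨Int.fract_nonneg t, (Int.fract_lt_one t).le⟩).2 x (mem_univ x) hρs.ne')
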